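/- Let $p \neq 2, 3$ be a prime. For an elliptic curve $E$ over $\mathbb{Q}_p$ define its $p$-degree by $$d_p(E) = \min\{[\mathbb{Q}_p(P):\mathbb{Q}_p] : P \in E(\overline{\mathbb{Q}}_p),\ pP = \mathcal{O},\ P \neq \mathcal{O}\},$$ where $\mathbb{Q}_p(P)$ denotes the field obtained by adjoining to $\mathbb{Q}_p$ the coordinates of $P$. Let $E_1, E_2$ be elliptic curves over $\mathbb{Q}_p$ with good reduction, and let their reductions to $\mathbb{Z}/p^2$ be the elliptic curves over $\mathbb{Z}/p^2$ obtained by reducing modulo $p^2$ the coefficients of minimal Weierstrass equations over $\mathbb{Z}_p$. If the reductions of $E_1$ and $E_2$ to $\mathbb{Z}/p^2$ are isomorphic over $\mathbb{Z}/p^2$, then $d_p(E_1) = d_p(E_2)$. -/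

import Mathlib

namespace WeierstrassCurve

/-- Two Weierstrass curves over `R` are isomorphic if an admissible change of variables
`(x, y) ↦ (u²x + r, u³y + u²sx + t)` over `R` takes one into the other. -/
def Isomorphic {R : Type*} [CommRing R] (W W' : WeierstrassCurve R) : Prop :=
  ∃ C : VariableChange R, C • W = W'

/-- `E / ℚ_p` has good reduction, and `W` is its reduction to `ℤ/pⁿ`: some Weierstrass equation
`C • E` of `E` over `ℚ_p` is a minimal equation over `ℤ_p` whose discriminant is a unit, and `W` is
obtained by reducing its coefficients (in `ℤ_p`) modulo `pⁿ`. -/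
def IsGoodReductionMod {p : ℕ} [Fact p.Prime] (E : WeierstrassCurve ℚ_[p]) (n : ℕ)
    (W : WeierstrassCurve (ZMod (p ^ n))) : Prop :=
  ∃ (C : VariableChange ℚ_[p]) (_ : (C • E).HasGoodReduction ℤ_[p]),
    ((C • E).integralModel ℤ_[p]).map (PadicInt.toZModPow n) = W

/-- The field obtained by adjoining to `F` the coordinates of a point `P ∈ E(L)`
(for the point at infinity it is `F` itself). -/
def coordinateField {F L : Type*} [Field F] [Field L] [Algebra F L] {E : WeierstrassCurve F} :
    (E.baseChange L).toAffine.Point → IntermediateField F L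
  | .zero => ⊥
  | .some x y _ => IntermediateField.adjoin F {x, y}

open scoped Classical in
/-- The `p`-degree of an elliptic curve `E` over `ℚ_p`: the least degree over `ℚ_p` of the field
`ℚ_p(P)`, where `P` runs over the nonzero points of `E[p]` over the algebraic closure of `ℚ_p`. -/
noncomputable def pDegree {p : ℕ} [Fact p.Prime] (E : WeierstrassCurve ℚ_[p]) : ℕ :=
  sInf {d : ℕ | ∃ P : (E.baseChange (AlgebraicClosure ℚ_[p])).toAffine.Point,
    p • P = 0 ∧ P ≠ 0 ∧ d = Module.finrank ℚ_[p] (coordinateField P)}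

end WeierstrassCurve

/-! The `p`-degree depends only on the set of finite extensions `K / ℚ_p` over which there is a
nonzero point killed by `p` (`pDegree_eq_of_hasTorsion_iff`), so it suffices to carry such points
from one curve to the other over each `K`. The isomorphism over `ℤ/p²` lifts to a change of
variables over `ℤ_p`, and 2 and 3 are units. Hence both curves may be taken in the form `y² = x³ +
ax + b` with unit discriminant and with coefficients congruent modulo `p²`.

Let `P ≠ 0` satisfy `pP = 0` on the first curve over `K`. By continuity there is a point `P'` of the
second curve congruent to `P` modulo `p²`, and then `pP'` lies in the kernel of reduction with
`|z(pP')| ≤ |p|²`, where `z = -x/y` (`exists_nsmul_inKernel_of_congruent`). For short equations the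
formal group satisfies `[p]z = pz + O(z⁵)`, so multiplication by `p` maps the disc `|z| ≤ |p|` onto
the disc `|z| ≤ |p|²` (`exists_nsmul_eq_of_inKernel`). This gives `Q` with `|z(Q)| ≤ |p|` and `pQ =
pP'`, and `P' - Q` is killed by `p`.

It is nonzero: if `P'` is in the kernel of reduction, then `|z(P')| = |z(P)|`, and a nonzero
`p`-torsion point of the kernel has `|z| > |p|` (`norm_lt_of_nsmul_eq_zero`), so `P' ≠ Q`. -/

namespace WeierstrassCurve

/-! ### Changes of variables as group homomorphisms on points. -/

section VariableChangePoint

variable {F : Type*} [Field F] (C : VariableChange F) (W : WeierstrassCurve F)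

lemma equation_variableChange_iff (x y : F) :
    (C • W).toAffine.Equation x y ↔
      W.toAffine.Equation (C.u ^ 2 * x + C.r) (C.u ^ 3 * y + C.u ^ 2 * C.s * x + C.t) := by
  have hu : (C.u : F) ≠ 0 := C.u.ne_zero
  rw [Affine.equation_iff', Affine.equation_iff']
  simp only [variableChange_def, Units.val_inv_eq_inv_val]
  rw [← mul_right_inj' (pow_ne_zero 6 hu), mul_zero]
  refine Eq.congr_left ?_
  field_simp
  ring

/-- The change of variables `(x, y) ↦ (u²x + r, u³y + u²sx + t)` as a group homomorphism on points. -/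
noncomputable def variableChangePoint [DecidableEq F] [W.IsElliptic] :
    (C • W).toAffine.Point →+ W.toAffine.Point where
  toFun P := match P with
    | .zero => 0
    | .some x y h => .some (C.u ^ 2 * x + C.r) (C.u ^ 3 * y + C.u ^ 2 * C.s * x + C.t)
        (Affine.equation_iff_nonsingular.mp ((equation_variableChange_iff C W x y).mp h.1))
  map_zero' := rfl
  map_add' := by
    have hu : (C.u : F) ≠ 0 := C.u.ne_zero
    rintro (_ | ⟨x₁, y₁, h₁⟩) (_ | ⟨x₂, y₂, h₂⟩)
    any_goals simp only [← Affine.Point.zero_def, zero_add, add_zero]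
    have hX : C.u ^ 2 * x₁ + C.r = C.u ^ 2 * x₂ + C.r ↔ x₁ = x₂ := by simp [hu]
    have hY : x₁ = x₂ → (C.u ^ 3 * y₁ + C.u ^ 2 * C.s * x₁ + C.t =
        W.toAffine.negY (C.u ^ 2 * x₂ + C.r) (C.u ^ 3 * y₂ + C.u ^ 2 * C.s * x₂ + C.t) ↔
          y₁ = (C • W).toAffine.negY x₂ y₂) := by
      rintro rfl
      simp only [Affine.negY, variableChange_def, Units.val_inv_eq_inv_val]
      rw [← mul_right_inj' (pow_ne_zero 3 hu) (b := y₁), ← sub_eq_zero, ← sub_eq_zero (a := _ * y₁)]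
      refine Eq.congr_left ?_
      field_simp
      ring
    by_cases hxy : x₁ = x₂ ∧ y₁ = (C • W).toAffine.negY x₂ y₂
    · rw [Affine.Point.add_of_Y_eq hxy.1 hxy.2,
        Affine.Point.add_of_Y_eq (hX.mpr hxy.1) ((hY hxy.1).mpr hxy.2)]
    · have hxy' : ¬ (C.u ^ 2 * x₁ + C.r = C.u ^ 2 * x₂ + C.r ∧
          C.u ^ 3 * y₁ + C.u ^ 2 * C.s * x₁ + C.t =
            W.toAffine.negY (C.u ^ 2 * x₂ + C.r) (C.u ^ 3 * y₂ + C.u ^ 2 * C.s * x₂ + C.t)) :=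
        fun h => hxy ⟨hX.mp h.1, (hY (hX.mp h.1)).mp h.2⟩
      rw [Affine.Point.add_some hxy, Affine.Point.add_some hxy']
      have hs : W.toAffine.slope (C.u ^ 2 * x₁ + C.r) (C.u ^ 2 * x₂ + C.r)
          (C.u ^ 3 * y₁ + C.u ^ 2 * C.s * x₁ + C.t) (C.u ^ 3 * y₂ + C.u ^ 2 * C.s * x₂ + C.t) =
          C.u * (C • W).toAffine.slope x₁ x₂ y₁ y₂ + C.s := by
        by_cases hx : x₁ = x₂
        · have hy := fun h => hxy ⟨hx, h⟩
          have hy' := fun h => hxy' ⟨hX.mpr hx, h⟩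
          rw [Affine.slope_of_Y_ne hx hy, Affine.slope_of_Y_ne (hX.mpr hx) hy']
          have hyy : y₁ = y₂ := Affine.Y_eq_of_Y_ne h₁.1 h₂.1 hx hy
          subst hx hyy
          replace hy := sub_ne_zero.mpr hy
          replace hy' := sub_ne_zero.mpr hy'
          rw [div_eq_iff hy', ← sub_eq_zero]
          have hd : C.u ^ 3 * y₁ + C.u ^ 2 * C.s * x₁ + C.t -
              W.toAffine.negY (C.u ^ 2 * x₁ + C.r) (C.u ^ 3 * y₁ + C.u ^ 2 * C.s * x₁ + C.t) =
              C.u ^ 3 * (y₁ - (C • W).toAffine.negY x₁ y₁) := by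
            simp only [Affine.negY, variableChange_def, Units.val_inv_eq_inv_val]
            field_simp
            ring
          rw [hd]
          field_simp
          simp only [Affine.negY, variableChange_def, Units.val_inv_eq_inv_val]
          field_simp
          ring
        · rw [Affine.slope_of_X_ne hx, Affine.slope_of_X_ne (hX.not.mpr hx)]
          have : x₁ - x₂ ≠ 0 := sub_ne_zero.mpr hx
          have h' : C.u ^ 2 * x₁ + C.r - (C.u ^ 2 * x₂ + C.r) = C.u ^ 2 * (x₁ - x₂) := by ring
          rw [h']
          field_simp
          ring
      simp only [Affine.Point.some.injEq, hs]
      constructor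
      · simp only [Affine.addX, variableChange_def, Units.val_inv_eq_inv_val]
        field_simp
        ring
      · simp only [Affine.addX, Affine.addY, Affine.negAddY, Affine.negY, variableChange_def,
          Units.val_inv_eq_inv_val]
        field_simp
        ring

lemma variableChangePoint_injective [DecidableEq F] [W.IsElliptic] :
    Function.Injective (variableChangePoint C W) := by
  rw [injective_iff_map_eq_zero]
  rintro (_ | ⟨x, y, h⟩) hP
  · rfl
  · exact absurd hP (Affine.Point.some_ne_zero _)

end VariableChangePoint

/-! ### Torsion over intermediate fields and the `p`-degree. -/

open scoped Classical in
/-- The existence of a nonzero rational point killed by `n`. -/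
def HasTorsion {F : Type*} [Field F] (W : WeierstrassCurve F) (n : ℕ) : Prop :=
  ∃ P : W.toAffine.Point, n • P = 0 ∧ P ≠ 0

lemma HasTorsion.of_variableChange {F : Type*} [Field F] {W : WeierstrassCurve F} [W.IsElliptic]
    {n : ℕ} (C : VariableChange F) (h : (C • W).HasTorsion n) : W.HasTorsion n := by
  classical
  obtain ⟨P, hP, hP0⟩ := h
  refine ⟨variableChangePoint C W P, ?_, ?_⟩
  · rw [← map_nsmul, hP, map_zero]
  · rwa [Ne, map_eq_zero_iff _ (variableChangePoint_injective C W)]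

lemma hasTorsion_variableChange_iff {F : Type*} [Field F] {W : WeierstrassCurve F} [W.IsElliptic]
    {n : ℕ} (C : VariableChange F) : (C • W).HasTorsion n ↔ W.HasTorsion n :=
  ⟨.of_variableChange C, fun h => .of_variableChange C⁻¹ (by rwa [inv_smul_smul])⟩

-- A point with coordinates in `K` descends to `K`, and the injection `E(K) → E(L)` preserves and
-- reflects being killed by `n`. This turns degrees of coordinate fields into the question of which
-- fields carry torsion.
open scoped Classical in
lemma exists_point_coordinateField_le {F L : Type*} [Field F] [Field L] [Algebra F L]
    (E : WeierstrassCurve F) (n : ℕ) (K : IntermediateField F L) :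
    (E.baseChange K).HasTorsion n ↔
      ∃ P : (E.baseChange L).toAffine.Point, n • P = 0 ∧ P ≠ 0 ∧ coordinateField P ≤ K := by
  constructor
  · rintro ⟨P, hP, hP0⟩
    let f := Affine.Point.map (W' := E) K.val
    refine ⟨f P, ?_, ?_, ?_⟩
    · refine (map_nsmul f n P).symm.trans ((congrArg f ?_).trans (map_zero f))
      convert hP
    · exact (map_ne_zero_iff f (Affine.Point.map_injective K.val)).mpr hP0
    · rcases P with _ | ⟨x, y, h⟩
      · exact bot_le
      · refine IntermediateField.adjoin_le_iff.mpr ?_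
        rintro _ (rfl | rfl)
        exacts [x.2, y.2]
  · rintro ⟨_ | ⟨x, y, h⟩, hP, hP0, hK⟩
    · exact absurd rfl hP0
    · have hK := IntermediateField.adjoin_le_iff.mp hK
      have hx : x ∈ K := hK (by simp)
      have hy : y ∈ K := hK (by simp)
      have hxy : (E.baseChange K).toAffine.Nonsingular ⟨x, hx⟩ ⟨y, hy⟩ :=
        (Affine.baseChange_nonsingular E (f := K.val) K.val.injective _ _).mp h
      have hm : Affine.Point.map (W' := E) K.val (.some _ _ hxy) = .some x y h := rfl
      refine ⟨.some _ _ hxy, ?_, Affine.Point.some_ne_zero _⟩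
      have hz : Affine.Point.map (W' := E) K.val (n • .some _ _ hxy) = 0 := by
        refine (map_nsmul (Affine.Point.map (W' := E) K.val) n _).trans ?_
        rw [hm]
        convert hP
      have := (map_eq_zero_iff _ (Affine.Point.map_injective (W' := E) K.val)).mp hz
      convert this

lemma finiteDimensional_coordinateField {F L : Type*} [Field F] [Field L] [Algebra F L]
    [Algebra.IsAlgebraic F L] {E : WeierstrassCurve F} (P : (E.baseChange L).toAffine.Point) :
    FiniteDimensional F (coordinateField P) := by
  rcases P with _ | ⟨x, y, h⟩
  · exact inferInstanceAs (FiniteDimensional F (⊥ : IntermediateField F L))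
  · exact IntermediateField.finiteDimensional_adjoin
      fun x _ => Algebra.IsIntegral.isIntegral x

/-- The `p`-degree is determined by the finite extensions of `ℚ_p` over which there is a point
of order `p`. -/
lemma pDegree_eq_of_hasTorsion_iff {p : ℕ} [Fact p.Prime] {E₁ E₂ : WeierstrassCurve ℚ_[p]}
    (h : ∀ K : IntermediateField ℚ_[p] (AlgebraicClosure ℚ_[p]), FiniteDimensional ℚ_[p] K →
      ((E₁.baseChange K).HasTorsion p ↔ (E₂.baseChange K).HasTorsion p)) :
    E₁.pDegree = E₂.pDegree := by
  classical
  have key : ∀ E₁ E₂ : WeierstrassCurve ℚ_[p],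
      (∀ K : IntermediateField ℚ_[p] (AlgebraicClosure ℚ_[p]), FiniteDimensional ℚ_[p] K →
        (E₁.baseChange K).HasTorsion p → (E₂.baseChange K).HasTorsion p) →
      ∀ P : (E₁.baseChange (AlgebraicClosure ℚ_[p])).toAffine.Point, p • P = 0 → P ≠ 0 →
      ∃ Q : (E₂.baseChange (AlgebraicClosure ℚ_[p])).toAffine.Point, p • Q = 0 ∧ Q ≠ 0 ∧
        Module.finrank ℚ_[p] (coordinateField Q) ≤ Module.finrank ℚ_[p] (coordinateField P) := by
    intro E₁ E₂ h P hP hP0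
    have hfd := finiteDimensional_coordinateField P
    obtain ⟨Q, hQ, hQ0, hle⟩ := (exists_point_coordinateField_le E₂ p _).mp
      (h _ hfd ((exists_point_coordinateField_le E₁ p _).mpr ⟨P, by convert hP, hP0, le_rfl⟩))
    exact ⟨Q, by convert hQ, hQ0, IntermediateField.finrank_le_of_le_right hle⟩
  have le : ∀ E₁ E₂ : WeierstrassCurve ℚ_[p],
      (∀ K : IntermediateField ℚ_[p] (AlgebraicClosure ℚ_[p]), FiniteDimensional ℚ_[p] K →
        ((E₁.baseChange K).HasTorsion p ↔ (E₂.baseChange K).HasTorsion p)) →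
      E₁.pDegree ≤ E₂.pDegree := by
    intro E₁ E₂ h
    unfold pDegree
    set S := {d : ℕ | ∃ P : (E₂.baseChange (AlgebraicClosure ℚ_[p])).toAffine.Point,
      p • P = 0 ∧ P ≠ 0 ∧ d = Module.finrank ℚ_[p] (coordinateField P)} with hS
    -- On `ℕ` the infimum of the empty set is 0, so if `S` is empty the corresponding set for `E₁`
    -- must be shown empty too.
    rcases S.eq_empty_or_nonempty with he | hne
    · refine le_of_eq_of_le ?_ (Nat.zero_le _)
      rw [Nat.sInf_eq_zero]
      right
      rw [Set.eq_empty_iff_forall_notMem]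
      rintro d ⟨P, hP, hP0, -⟩
      obtain ⟨Q, hQ, hQ0, -⟩ := key E₁ E₂ (fun K hK => (h K hK).mp) P hP hP0
      have hmem : Module.finrank ℚ_[p] (coordinateField Q) ∈ S := ⟨Q, hQ, hQ0, rfl⟩
      rwa [he] at hmem
    · obtain ⟨P, hP, hP0, hd⟩ := Nat.sInf_mem hne
      obtain ⟨Q, hQ, hQ0, hle⟩ := key E₂ E₁ (fun K hK => (h K hK).mpr) P hP hP0
      refine (Nat.sInf_le ?_).trans (hle.trans_eq hd.symm)
      exact ⟨Q, hQ, hQ0, rfl⟩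
  exact (le _ _ h).antisymm (le _ _ fun K hK => (h K hK).symm)

/-! ### Ultrametric estimates, congruences of integral elements, contractions. -/

section Ultrametric

variable {K : Type*} [NormedField K] [IsUltrametricDist K] {x y : K} {r : ℝ}

lemma norm_add_le_of_le_ultra (hx : ‖x‖ ≤ r) (hy : ‖y‖ ≤ r) : ‖x + y‖ ≤ r :=
  (IsUltrametricDist.norm_add_le_max x y).trans (max_le hx hy)

lemma norm_sub_le_of_le_ultra (hx : ‖x‖ ≤ r) (hy : ‖y‖ ≤ r) : ‖x - y‖ ≤ r :=
  sub_eq_add_neg x y ▸ norm_add_le_of_le_ultra hx (by rwa [norm_neg])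

lemma norm_add_lt_of_lt_ultra (hx : ‖x‖ < r) (hy : ‖y‖ < r) : ‖x + y‖ < r :=
  (IsUltrametricDist.norm_add_le_max x y).trans_lt (max_lt hx hy)

lemma norm_sub_lt_of_lt_ultra (hx : ‖x‖ < r) (hy : ‖y‖ < r) : ‖x - y‖ < r :=
  sub_eq_add_neg x y ▸ norm_add_lt_of_lt_ultra hx (by rwa [norm_neg])

lemma norm_add_eq_left_of_lt (h : ‖y‖ < ‖x‖) : ‖x + y‖ = ‖x‖ := by
  rw [IsUltrametricDist.norm_add_eq_max_of_norm_ne_norm h.ne', max_eq_left h.le]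

lemma norm_eq_of_norm_sub_lt (h : ‖y - x‖ < ‖x‖) : ‖y‖ = ‖x‖ := by
  simpa using norm_add_eq_left_of_lt h

lemma norm_one_add_eq_one (h : ‖x‖ < 1) : ‖1 + x‖ = 1 := by
  simpa using norm_add_eq_left_of_lt (x := (1 : K)) (by simpa using h)

lemma norm_one_sub_eq_one (h : ‖x‖ < 1) : ‖1 - x‖ = 1 := by
  simpa [sub_eq_add_neg] using norm_one_add_eq_one (x := -x) (by simpa using h)

lemma norm_ofNat_le_one (n : ℕ) [n.AtLeastTwo] : ‖(ofNat(n) : K)‖ ≤ 1 := by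
  rw [← Nat.cast_ofNat]
  exact IsUltrametricDist.norm_natCast_le_one K _

lemma norm_mul_le_left {K : Type*} [NormedField K] {x y : K} {r : ℝ}
    (hx : ‖x‖ ≤ 1) (hy : ‖y‖ ≤ r) : ‖x * y‖ ≤ r := by
  rw [norm_mul]
  exact (mul_le_of_le_one_left (norm_nonneg y) hx).trans hy

lemma norm_mul_le_right {K : Type*} [NormedField K] {x y : K} {r : ℝ}
    (hx : ‖x‖ ≤ r) (hy : ‖y‖ ≤ 1) : ‖x * y‖ ≤ r := by
  rw [mul_comm]
  exact norm_mul_le_left hy hx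

/-- Two integral elements that are congruent to within `ε`. -/
structure IntegralCong (ε : ℝ) (x y : K) : Prop where
  left : ‖x‖ ≤ 1
  right : ‖y‖ ≤ 1
  sub : ‖x - y‖ ≤ ε

namespace IntegralCong

variable {ε : ℝ} {x₁ x₂ y₁ y₂ : K}

lemma refl {K : Type*} [NormedField K] {x : K} {ε : ℝ} (hε : 0 ≤ ε) (hx : ‖x‖ ≤ 1) :
    IntegralCong ε x x :=
  ⟨hx, hx, by simpa⟩

lemma add (hx : IntegralCong ε x₁ x₂) (hy : IntegralCong ε y₁ y₂) :
    IntegralCong ε (x₁ + y₁) (x₂ + y₂) where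
  left := norm_add_le_of_le_ultra hx.1 hy.1
  right := norm_add_le_of_le_ultra hx.2 hy.2
  sub := by
    rw [add_sub_add_comm]
    exact norm_add_le_of_le_ultra hx.3 hy.3

lemma neg {K : Type*} [NormedField K] {x₁ x₂ : K} {ε : ℝ} (hx : IntegralCong ε x₁ x₂) :
    IntegralCong ε (-x₁) (-x₂) where
  left := by simpa using hx.1
  right := by simpa using hx.2
  sub := by rw [neg_sub_neg, norm_sub_rev]; exact hx.3

lemma diff (hx : IntegralCong ε x₁ x₂) (hy : IntegralCong ε y₁ y₂) :
    IntegralCong ε (x₁ - y₁) (x₂ - y₂) := by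
  simpa [sub_eq_add_neg] using hx.add hy.neg

lemma mul (hx : IntegralCong ε x₁ x₂) (hy : IntegralCong ε y₁ y₂) :
    IntegralCong ε (x₁ * y₁) (x₂ * y₂) where
  left := norm_mul_le_left hx.1 hy.1
  right := norm_mul_le_left hx.2 hy.2
  sub := by
    rw [show x₁ * y₁ - x₂ * y₂ = x₁ * (y₁ - y₂) + (x₁ - x₂) * y₂ by ring]
    exact norm_add_le_of_le_ultra (norm_mul_le_left hx.1 hy.3) (norm_mul_le_right hx.3 hy.2)

lemma pow (hx : IntegralCong ε x₁ x₂) (hε : 0 ≤ ε) (n : ℕ) :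
    IntegralCong ε (x₁ ^ n) (x₂ ^ n) := by
  induction n with
  | zero => simpa using refl hε (by simp)
  | succ n ih => simpa [pow_succ] using ih.mul hx

lemma div (hx : IntegralCong ε x₁ x₂) (hy : IntegralCong ε y₁ y₂) (h₁ : ‖y₁‖ = 1)
    (h₂ : ‖y₂‖ = 1) : IntegralCong ε (x₁ / y₁) (x₂ / y₂) where
  left := by simpa [h₁] using hx.1
  right := by simpa [h₂] using hx.2
  sub := by
    have h₁' : y₁ ≠ 0 := norm_ne_zero_iff.mp (by simp [h₁])
    have h₂' : y₂ ≠ 0 := norm_ne_zero_iff.mp (by simp [h₂])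
    rw [show x₁ / y₁ - x₂ / y₂ = ((x₁ - x₂) * y₁ - x₁ * (y₁ - y₂)) / (y₁ * y₂) by
      field_simp; ring]
    simp only [norm_div, norm_mul _ y₂, h₁, h₂, mul_one, div_one]
    exact norm_sub_le_of_le_ultra (norm_mul_le_right hx.3 hy.1) (norm_mul_le_left hx.1 hy.3)

end IntegralCong

/-- A contraction of a closed ball about `0` in a complete field has a fixed point. -/
lemma exists_fixedPoint_of_contracting {K : Type*} [NormedField K] [CompleteSpace K] {r c : ℝ}
    (hr : 0 ≤ r) (hc : c < 1) (f : K → K) (hf : ∀ t, ‖t‖ ≤ r → ‖f t‖ ≤ r)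
    (hfc : ∀ s t, ‖s‖ ≤ r → ‖t‖ ≤ r → ‖f s - f t‖ ≤ c * ‖s - t‖) : ∃ t, ‖t‖ ≤ r ∧ f t = t := by
  have hmaps : Set.MapsTo f (Metric.closedBall 0 r) (Metric.closedBall 0 r) := fun t ht => by
    simpa using hf t (by simpa using ht)
  have hcon : ContractingWith c.toNNReal (hmaps.restrict f _ _) := by
    refine ⟨by simpa using hc, LipschitzWith.of_dist_le_mul fun s t => ?_⟩
    have h := hfc s t (mem_closedBall_zero_iff.mp s.2) (mem_closedBall_zero_iff.mp t.2)
    rw [Subtype.dist_eq, Subtype.dist_eq, dist_eq_norm, dist_eq_norm]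
    exact h.trans (mul_le_mul_of_nonneg_right (Real.le_coe_toNNReal c) (norm_nonneg _))
  obtain ⟨t, ht, hft, -⟩ := hcon.exists_fixedPoint' Metric.isClosed_closedBall.isComplete hmaps
    (x := 0) (by simpa using hr) (edist_ne_top _ _)
  exact ⟨t, by simpa using ht, hft⟩

end Ultrametric

/-! ### The group law near the origin in the coordinates `z = -x/y`, `w = -1/y`. -/

section Chart

variable {K : Type*}

section Formulas

variable [Field K] (a b z₁ w₁ z₂ w₂ : K)

/-- The denominator of the slope of the line through two points of `w = z³ + azw² + bw³`. -/
def chartDen : K := 1 - a * z₁ * (w₁ + w₂) - b * (w₁ ^ 2 + w₁ * w₂ + w₂ ^ 2)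

/-- The slope of the line through two points of `w = z³ + azw² + bw³`. -/
def chartSlope : K := (z₁ ^ 2 + z₁ * z₂ + z₂ ^ 2 + a * w₂ ^ 2) / chartDen a b z₁ w₁ w₂

/-- The intercept of the line through two points of `w = z³ + azw² + bw³`. -/
def chartIntercept : K := w₁ - chartSlope a b z₁ w₁ z₂ w₂ * z₁

/-- The leading coefficient of the cubic equation for the points of `w = z³ + azw² + bw³` on a
line of slope `l`. -/
def chartLead (l : K) : K := 1 + a * l ^ 2 + b * l ^ 3

/-- The `z`-coordinate of a sum of points of `w = z³ + azw² + bw³`. -/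
def chartAddZ : K :=
  z₁ + z₂ + chartIntercept a b z₁ w₁ z₂ w₂ * (2 * a * chartSlope a b z₁ w₁ z₂ w₂ +
    3 * b * chartSlope a b z₁ w₁ z₂ w₂ ^ 2) / chartLead a b (chartSlope a b z₁ w₁ z₂ w₂)

/-- The `w`-coordinate of a sum of points of `w = z³ + azw² + bw³`. -/
def chartAddW : K :=
  chartSlope a b z₁ w₁ z₂ w₂ * chartAddZ a b z₁ w₁ z₂ w₂ - chartIntercept a b z₁ w₁ z₂ w₂

variable {a b z₁ w₁ z₂ w₂}

/-- The formulas for the addition in the chart `z = -x/y`, `w = -1/y`, for points on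
`y = ℓx + m`. -/
lemma chartAdd_of_line {x₁ x₂ ℓ m : K} (h₁ : ℓ * x₁ + m ≠ 0) (h₂ : ℓ * x₂ + m ≠ 0)
    (ha : a = 2 * ℓ * m + x₁ * x₂ + (x₁ + x₂) * (ℓ ^ 2 - x₁ - x₂))
    (hb : b = m ^ 2 - x₁ * x₂ * (ℓ ^ 2 - x₁ - x₂))
    (hz₁ : z₁ = -x₁ / (ℓ * x₁ + m)) (hw₁ : w₁ = -1 / (ℓ * x₁ + m))
    (hz₂ : z₂ = -x₂ / (ℓ * x₂ + m)) (hw₂ : w₂ = -1 / (ℓ * x₂ + m))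
    (hD : chartDen a b z₁ w₁ w₂ ≠ 0) (hE : chartLead a b (chartSlope a b z₁ w₁ z₂ w₂) ≠ 0) :
    ℓ * (ℓ ^ 2 - x₁ - x₂) + m ≠ 0 ∧
      -(ℓ ^ 2 - x₁ - x₂) / -(ℓ * (ℓ ^ 2 - x₁ - x₂) + m) = chartAddZ a b z₁ w₁ z₂ w₂ ∧
      -1 / -(ℓ * (ℓ ^ 2 - x₁ - x₂) + m) = chartAddW a b z₁ w₁ z₂ w₂ := by
  -- `ha` and `hb` are Vieta's relations for the roots `x₁`, `x₂`, `ℓ² - x₁ - x₂` of `x³ + ax + b =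
  -- (ℓx + m)²`. In the chart the line `y = ℓx + m` reads `w = -(ℓ/m)z - 1/m`, which gives the slope
  -- and intercept below.
  have hN : (z₁ ^ 2 + z₁ * z₂ + z₂ ^ 2 + a * w₂ ^ 2) * m = -ℓ * chartDen a b z₁ w₁ w₂ := by
    rw [chartDen, hz₁, hw₁, hz₂, hw₂]
    generalize hy₁ : ℓ * x₁ + m = y₁ at h₁
    generalize hy₂ : ℓ * x₂ + m = y₂ at h₂
    field_simp
    rw [ha, hb, ← hy₁, ← hy₂]
    ring
  have hm : m ≠ 0 := by
    rintro rfl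
    have : ℓ = 0 := by
      have := hN.symm
      simpa [hD] using this
    simp [this] at h₁
  have hl : chartSlope a b z₁ w₁ z₂ w₂ = -ℓ / m := by
    rw [chartSlope, div_eq_div_iff hD hm, hN]
  have hn : chartIntercept a b z₁ w₁ z₂ w₂ = -1 / m := by
    rw [chartIntercept, hl, hw₁, hz₁]
    field_simp
    ring
  -- Up to `m³`, the leading coefficient is the product of the `y`-coordinates of the three
  -- intersection points, so its nonvanishing puts the third point in the chart.
  have hlead : chartLead a b (-ℓ / m) =
      (ℓ * x₁ + m) * (ℓ * x₂ + m) * (ℓ * (ℓ ^ 2 - x₁ - x₂) + m) / m ^ 3 := by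
    rw [chartLead, ha, hb]
    field_simp
    ring
  rw [hl, hlead] at hE
  have h₃ : ℓ * (ℓ ^ 2 - x₁ - x₂) + m ≠ 0 := fun h => hE (by rw [h]; simp)
  have hZ : -(ℓ ^ 2 - x₁ - x₂) / -(ℓ * (ℓ ^ 2 - x₁ - x₂) + m) = chartAddZ a b z₁ w₁ z₂ w₂ := by
    rw [chartAddZ, hn, hl, hlead, hz₁, hz₂, neg_div_neg_eq]
    generalize hx₃ : ℓ ^ 2 - x₁ - x₂ = x₃ at *
    have : x₂ = ℓ ^ 2 - x₁ - x₃ := by rw [← hx₃]; ring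
    generalize hy₁ : ℓ * x₁ + m = y₁ at h₁
    generalize hy₂ : ℓ * x₂ + m = y₂ at h₂
    generalize hy₃ : ℓ * x₃ + m = y₃ at h₃
    field_simp
    rw [ha, hb, ← hy₁, ← hy₂, ← hy₃, this]
    ring
  refine ⟨h₃, hZ, ?_⟩
  rw [chartAddW, ← hZ, hl, hn]
  field_simp
  ring

end Formulas

variable [NormedField K] [IsUltrametricDist K] {a b z₁ w₁ z₂ w₂ : K} {r : ℝ}

lemma norm_chartDen (ha : ‖a‖ ≤ 1) (hb : ‖b‖ ≤ 1) (hz₁ : ‖z₁‖ ≤ 1) (hw₁ : ‖w₁‖ < 1)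
    (hw₂ : ‖w₂‖ < 1) : ‖chartDen a b z₁ w₁ w₂‖ = 1 := by
  have hmul : ∀ {x y : K}, ‖x‖ ≤ 1 → ‖y‖ < 1 → ‖x * y‖ < 1 := fun hx hy => by
    rw [norm_mul]
    exact (mul_le_of_le_one_left (norm_nonneg _) hx).trans_lt hy
  rw [chartDen, sub_sub]
  refine norm_one_sub_eq_one (norm_add_lt_of_lt_ultra (hmul (norm_mul_le_left ha hz₁)
    (norm_add_lt_of_lt_ultra hw₁ hw₂)) (hmul hb ?_))
  rw [sq, sq]
  exact norm_add_lt_of_lt_ultra (norm_add_lt_of_lt_ultra (hmul hw₁.le hw₁) (hmul hw₁.le hw₂))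
    (hmul hw₂.le hw₂)

lemma norm_chartSlope_le (ha : ‖a‖ ≤ 1) (hb : ‖b‖ ≤ 1) (hr : r < 1) (hz₁ : ‖z₁‖ ≤ r)
    (hz₂ : ‖z₂‖ ≤ r) (hw₁ : ‖w₁‖ ≤ r) (hw₂ : ‖w₂‖ ≤ r) :
    ‖chartSlope a b z₁ w₁ z₂ w₂‖ ≤ r ^ 2 := by
  rw [chartSlope, norm_div, norm_chartDen ha hb (hz₁.trans hr.le) (hw₁.trans_lt hr)
    (hw₂.trans_lt hr), div_one]
  have hmul : ∀ {x y : K}, ‖x‖ ≤ r → ‖y‖ ≤ r → ‖x * y‖ ≤ r ^ 2 := fun hx hy => by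
    rw [sq]
    exact norm_mul_le_of_le hx hy
  rw [sq z₁, sq z₂, sq w₂]
  exact norm_add_le_of_le_ultra (norm_add_le_of_le_ultra (norm_add_le_of_le_ultra (hmul hz₁ hz₁)
    (hmul hz₁ hz₂)) (hmul hz₂ hz₂)) (norm_mul_le_left ha (hmul hw₂ hw₂))

lemma norm_chartLead {l : K} (ha : ‖a‖ ≤ 1) (hb : ‖b‖ ≤ 1) (hl : ‖l‖ < 1) :
    ‖chartLead a b l‖ = 1 := by
  rw [chartLead, add_assoc]
  refine norm_one_add_eq_one (norm_add_lt_of_lt_ultra ?_ ?_) <;> rw [norm_mul, norm_pow]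
  · exact (mul_le_of_le_one_left (by positivity) ha).trans_lt
      (pow_lt_one₀ (norm_nonneg _) hl (by simp))
  · exact (mul_le_of_le_one_left (by positivity) hb).trans_lt
      (pow_lt_one₀ (norm_nonneg _) hl (by simp))

lemma norm_chartIntercept_le (ha : ‖a‖ ≤ 1) (hb : ‖b‖ ≤ 1) (hr : r < 1) (hz₁ : ‖z₁‖ ≤ r)
    (hz₂ : ‖z₂‖ ≤ r) (hw₁ : ‖w₁‖ ≤ ‖z₁‖ ^ 3) (hw₂ : ‖w₂‖ ≤ r) :
    ‖chartIntercept a b z₁ w₁ z₂ w₂‖ ≤ r ^ 2 * ‖z₁‖ := by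
  have hr0 : 0 ≤ r := (norm_nonneg _).trans hz₁
  have h3 : ‖z₁‖ ^ 3 ≤ r ^ 2 * ‖z₁‖ := by
    rw [pow_succ]
    gcongr
  have hw₁' : ‖w₁‖ ≤ r := by
    refine hw₁.trans (le_trans ?_ hz₁)
    exact pow_le_of_le_one (norm_nonneg _) (hz₁.trans hr.le) (by simp)
  refine norm_sub_le_of_le_ultra (hw₁.trans h3) ?_
  rw [norm_mul]
  gcongr
  exact norm_chartSlope_le ha hb hr hz₁ hz₂ hw₁' hw₂

/-- The formal group law of a short equation is `z₁ + z₂` plus terms of degree at least 5: the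
correction is an intercept of size `r²‖z₁‖` times a factor of size `r²`. Keeping `‖z₁‖` rather than
`r` is what later makes `z` an isometry and multiplication by `n` a small perturbation of `z ↦ nz`.
-/
lemma norm_chartAddZ_sub_le (ha : ‖a‖ ≤ 1) (hb : ‖b‖ ≤ 1) (hr : r < 1) (hz₁ : ‖z₁‖ ≤ r)
    (hz₂ : ‖z₂‖ ≤ r) (hw₁ : ‖w₁‖ ≤ ‖z₁‖ ^ 3) (hw₂ : ‖w₂‖ ≤ r) :
    ‖chartAddZ a b z₁ w₁ z₂ w₂ - z₁ - z₂‖ ≤ r ^ 4 * ‖z₁‖ := by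
  have hr0 : 0 ≤ r := (norm_nonneg _).trans hz₁
  have hw₁' : ‖w₁‖ ≤ r := by
    refine hw₁.trans (le_trans ?_ hz₁)
    exact pow_le_of_le_one (norm_nonneg _) (hz₁.trans hr.le) (by simp)
  have hl := norm_chartSlope_le ha hb hr hz₁ hz₂ hw₁' hw₂
  have hr2 : r ^ 2 < 1 := pow_lt_one₀ hr0 hr (by simp)
  have hn := norm_chartIntercept_le ha hb hr hz₁ hz₂ hw₁ hw₂
  rw [chartAddZ, sub_sub, add_sub_cancel_left, norm_div,
    norm_chartLead ha hb (hl.trans_lt hr2), div_one, norm_mul,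
    show r ^ 4 * ‖z₁‖ = r ^ 2 * ‖z₁‖ * r ^ 2 by ring]
  gcongr
  refine norm_add_le_of_le_ultra (norm_mul_le_left (norm_mul_le_left (norm_ofNat_le_one 2) ha) hl)
    (norm_mul_le_left (norm_mul_le_left (norm_ofNat_le_one 3) hb) ?_)
  rw [sq]
  exact norm_mul_le_left (hl.trans hr2.le) hl

lemma norm_chartAddZ_lt_one (ha : ‖a‖ ≤ 1) (hb : ‖b‖ ≤ 1) (hz₁ : ‖z₁‖ < 1)
    (hz₂ : ‖z₂‖ < 1) (hw₁ : ‖w₁‖ ≤ ‖z₁‖ ^ 3) (hw₂ : ‖w₂‖ ≤ ‖z₂‖ ^ 3) :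
    ‖chartAddZ a b z₁ w₁ z₂ w₂‖ < 1 ∧ ‖chartAddW a b z₁ w₁ z₂ w₂‖ < 1 := by
  obtain ⟨r, hr0, hr, h1, h2⟩ : ∃ r : ℝ, 0 ≤ r ∧ r < 1 ∧ ‖z₁‖ ≤ r ∧ ‖z₂‖ ≤ r :=
    ⟨max ‖z₁‖ ‖z₂‖, le_max_of_le_left (norm_nonneg _), max_lt hz₁ hz₂, le_max_left _ _,
      le_max_right _ _⟩
  have hc : ∀ {z : K}, ‖z‖ ≤ r → ‖z‖ ^ 3 ≤ r := fun h =>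
    (pow_le_of_le_one (norm_nonneg _) (h.trans hr.le) (by simp)).trans h
  have hw₁' := hw₁.trans (hc h1)
  have hw₂' := hw₂.trans (hc h2)
  have hz : ‖chartAddZ a b z₁ w₁ z₂ w₂‖ ≤ r := by
    have h := norm_chartAddZ_sub_le ha hb hr h1 h2 hw₁ hw₂'
    have h4 : r ^ 4 * ‖z₁‖ ≤ r :=
      (mul_le_of_le_one_left (norm_nonneg _) (pow_le_one₀ hr0 hr.le)).trans h1
    rw [show chartAddZ a b z₁ w₁ z₂ w₂ = chartAddZ a b z₁ w₁ z₂ w₂ - z₁ - z₂ + z₁ + z₂ by ring]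
    exact norm_add_le_of_le_ultra (norm_add_le_of_le_ultra (h.trans h4) h1) h2
  refine ⟨hz.trans_lt hr, lt_of_le_of_lt (norm_sub_le_of_le_ultra (r := r) ?_ ?_) hr⟩
  · refine norm_mul_le_left ((norm_chartSlope_le ha hb hr h1 h2 hw₁' hw₂').trans ?_) hz
    exact pow_le_one₀ hr0 hr.le
  · refine (norm_chartIntercept_le ha hb hr h1 h2 hw₁ hw₂').trans ?_
    exact (mul_le_of_le_one_left (norm_nonneg _) (pow_le_one₀ hr0 hr.le)).trans h1

/-- The addition formulas are built from integral quantities by ring operations and by division by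
`chartDen` and `chartLead`, which are units on the open unit disc, so they respect congruences in
the curve as well as in the points. -/
lemma integralCong_chartAdd {ε : ℝ} (hε : 0 ≤ ε) {a' b' z₁' w₁' z₂' w₂' : K}
    (ha : IntegralCong ε a a') (hb : IntegralCong ε b b') (hz₁ : IntegralCong ε z₁ z₁')
    (hw₁ : IntegralCong ε w₁ w₁') (hz₂ : IntegralCong ε z₂ z₂') (hw₂ : IntegralCong ε w₂ w₂')
    (h₁ : ‖z₁‖ < 1) (h₂ : ‖z₂‖ < 1) (h₃ : ‖w₁‖ < 1) (h₄ : ‖w₂‖ < 1)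
    (h₁' : ‖z₁'‖ < 1) (h₂' : ‖z₂'‖ < 1) (h₃' : ‖w₁'‖ < 1) (h₄' : ‖w₂'‖ < 1) :
    IntegralCong ε (chartAddZ a b z₁ w₁ z₂ w₂) (chartAddZ a' b' z₁' w₁' z₂' w₂') ∧
      IntegralCong ε (chartAddW a b z₁ w₁ z₂ w₂) (chartAddW a' b' z₁' w₁' z₂' w₂') := by
  have hslope : ∀ {a b z₁ w₁ z₂ w₂ : K}, ‖a‖ ≤ 1 → ‖b‖ ≤ 1 → ‖z₁‖ < 1 → ‖z₂‖ < 1 → ‖w₁‖ < 1 →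
      ‖w₂‖ < 1 → ‖chartSlope a b z₁ w₁ z₂ w₂‖ < 1 := by
    intro a b z₁ w₁ z₂ w₂ ha hb h₁ h₂ h₃ h₄
    obtain ⟨r, hr0, hr, k₁, k₂, k₃, k₄⟩ : ∃ r : ℝ, 0 ≤ r ∧ r < 1 ∧ ‖z₁‖ ≤ r ∧ ‖z₂‖ ≤ r ∧
        ‖w₁‖ ≤ r ∧ ‖w₂‖ ≤ r :=
      ⟨max (max ‖z₁‖ ‖z₂‖) (max ‖w₁‖ ‖w₂‖), by positivity, by simp [*], by simp, by simp, by simp,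
        by simp⟩
    exact (norm_chartSlope_le ha hb hr k₁ k₂ k₃ k₄).trans_lt (pow_lt_one₀ hr0 hr (by simp))
  have two : IntegralCong ε (2 : K) 2 := .refl hε (norm_ofNat_le_one 2)
  have three : IntegralCong ε (3 : K) 3 := .refl hε (norm_ofNat_le_one 3)
  have one : IntegralCong ε (1 : K) 1 := .refl hε (by simp)
  have hD : IntegralCong ε (chartDen a b z₁ w₁ w₂) (chartDen a' b' z₁' w₁' w₂') :=
    (one.diff ((ha.mul hz₁).mul (hw₁.add hw₂))).diff
      (hb.mul (((hw₁.pow hε 2).add (hw₁.mul hw₂)).add (hw₂.pow hε 2)))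
  have hS : IntegralCong ε (chartSlope a b z₁ w₁ z₂ w₂) (chartSlope a' b' z₁' w₁' z₂' w₂') :=
    ((((hz₁.pow hε 2).add (hz₁.mul hz₂)).add (hz₂.pow hε 2)).add (ha.mul (hw₂.pow hε 2))).div hD
      (norm_chartDen ha.1 hb.1 hz₁.1 h₃ h₄) (norm_chartDen ha.2 hb.2 hz₁.2 h₃' h₄')
  have hI : IntegralCong ε (chartIntercept a b z₁ w₁ z₂ w₂)
      (chartIntercept a' b' z₁' w₁' z₂' w₂') := hw₁.diff (hS.mul hz₁)
  have hE : IntegralCong ε (chartLead a b (chartSlope a b z₁ w₁ z₂ w₂))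
      (chartLead a' b' (chartSlope a' b' z₁' w₁' z₂' w₂')) :=
    (one.add (ha.mul (hS.pow hε 2))).add (hb.mul (hS.pow hε 3))
  have hZ : IntegralCong ε (chartAddZ a b z₁ w₁ z₂ w₂) (chartAddZ a' b' z₁' w₁' z₂' w₂') :=
    (hz₁.add hz₂).add ((hI.mul (((two.mul ha).mul hS).add ((three.mul hb).mul (hS.pow hε 2)))).div
      hE (norm_chartLead ha.1 hb.1 (hslope ha.1 hb.1 h₁ h₂ h₃ h₄))
      (norm_chartLead ha.2 hb.2 (hslope ha.2 hb.2 h₁' h₂' h₃' h₄')))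
  exact ⟨hZ, (hS.mul hZ).diff hI⟩

end Chart

/-! ### Short Weierstrass curves with good reduction and the kernel of reduction. -/

section ShortCurve

variable {K : Type*}

/-- The Weierstrass curve `y² = x³ + ax + b`. -/
def shortCurve [Field K] (a b : K) : WeierstrassCurve K := ⟨0, 0, 0, a, b⟩

lemma shortCurve_equation_iff [Field K] {a b x y : K} :
    (shortCurve a b).toAffine.Equation x y ↔ y ^ 2 = x ^ 3 + a * x + b := by
  simp [Affine.equation_iff, shortCurve]

lemma shortCurve_negY [Field K] (a b x y : K) : (shortCurve a b).toAffine.negY x y = -y := by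
  simp [Affine.negY, shortCurve]

lemma shortCurve_Δ [Field K] (a b : K) :
    (shortCurve a b).Δ = -16 * (4 * a ^ 3 + 27 * b ^ 2) := by
  simp only [Δ, b₂, b₄, b₆, b₈, shortCurve]
  ring

section Field

variable [Field K] [DecidableEq K] {a b : K}

/-- Addition of points through the line `y = ℓx + m` joining them. -/
lemma exists_line_add (h2 : (2 : K) ≠ 0) {x₁ y₁ x₂ y₂ : K}
    (h₁ : (shortCurve a b).toAffine.Nonsingular x₁ y₁)
    (h₂ : (shortCurve a b).toAffine.Nonsingular x₂ y₂) (h : ¬(x₁ = x₂ ∧ y₁ = -y₂)) :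
    ∃ ℓ m : K, y₁ = ℓ * x₁ + m ∧ y₂ = ℓ * x₂ + m ∧
      a = 2 * ℓ * m + x₁ * x₂ + (x₁ + x₂) * (ℓ ^ 2 - x₁ - x₂) ∧
      b = m ^ 2 - x₁ * x₂ * (ℓ ^ 2 - x₁ - x₂) ∧
      (x₁ ≠ x₂ → ℓ = (y₁ - y₂) / (x₁ - x₂)) ∧
      (x₁ = x₂ → y₁ = y₂ ∧ y₁ ≠ 0 ∧ ℓ = (3 * x₁ ^ 2 + a) / (2 * y₁)) ∧
      ∃ h₃, (.some x₁ y₁ h₁ + .some x₂ y₂ h₂ : (shortCurve a b).toAffine.Point) =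
        .some (ℓ ^ 2 - x₁ - x₂) (-(ℓ * (ℓ ^ 2 - x₁ - x₂) + m)) h₃ := by
  have hxy : ¬(x₁ = x₂ ∧ y₁ = (shortCurve a b).toAffine.negY x₂ y₂) := by rwa [shortCurve_negY]
  have e₁ := shortCurve_equation_iff.mp h₁.1
  have e₂ := shortCurve_equation_iff.mp h₂.1
  set ℓ := (shortCurve a b).toAffine.slope x₁ x₂ y₁ y₂ with hℓ
  have hX : (shortCurve a b).toAffine.addX x₁ x₂ ℓ = ℓ ^ 2 - x₁ - x₂ := by
    simp [Affine.addX, shortCurve]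
  have hY : (shortCurve a b).toAffine.addY x₁ x₂ y₁ ℓ =
      -(ℓ * (ℓ ^ 2 - x₁ - x₂) + (y₁ - ℓ * x₁)) := by
    rw [Affine.addY, shortCurve_negY, Affine.negAddY, hX]
    ring
  have hadd : ∃ h₃, (.some x₁ y₁ h₁ + .some x₂ y₂ h₂ : (shortCurve a b).toAffine.Point) =
      .some (ℓ ^ 2 - x₁ - x₂) (-(ℓ * (ℓ ^ 2 - x₁ - x₂) + (y₁ - ℓ * x₁))) h₃ := by
    rw [Affine.Point.add_some hxy]
    simp only [← hℓ, hX, hY, exists_prop, and_true]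
    have := Affine.nonsingular_add h₁ h₂ hxy
    rwa [← hℓ, hX, hY] at this
  by_cases hx : x₁ = x₂
  · have hy : y₁ ≠ _ := fun h => hxy ⟨hx, h⟩
    have hyy : y₁ = y₂ := Affine.Y_eq_of_Y_ne h₁.1 h₂.1 hx hy
    have hs : ℓ = (3 * x₁ ^ 2 + a) / (2 * y₁) := by
      rw [hℓ, Affine.slope_of_Y_ne hx hy, shortCurve_negY]
      simp [shortCurve, two_mul]
    have hy0 : y₁ ≠ 0 := by
      rintro h0
      exact h ⟨hx, by rw [← hyy, h0, neg_zero]⟩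
    subst hx hyy
    have ha : a = 2 * y₁ * ℓ - 3 * x₁ ^ 2 := by
      rw [hs]
      field_simp
      ring
    refine ⟨ℓ, y₁ - ℓ * x₁, by ring, by ring, by rw [ha]; ring, ?_, fun h => absurd rfl h,
      fun _ => ⟨rfl, hy0, hs⟩, hadd⟩
    rw [show b = y₁ ^ 2 - x₁ ^ 3 - a * x₁ by rw [e₁]; ring, ha]
    ring
  · have hs : ℓ = (y₁ - y₂) / (x₁ - x₂) := by rw [hℓ, Affine.slope_of_X_ne hx]
    have hx' : x₁ - x₂ ≠ 0 := sub_ne_zero.mpr hx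
    have hy : y₁ - y₂ = ℓ * (x₁ - x₂) := by rw [hs]; field_simp
    -- The difference of the two curve equations, divided by `x₁ - x₂`.
    have ha : a = ℓ * (y₁ + y₂) - (x₁ ^ 2 + x₁ * x₂ + x₂ ^ 2) := by
      apply mul_left_cancel₀ hx'
      linear_combination e₂ - e₁ + (y₁ + y₂) * hy
    have hy₂ : y₂ = y₁ - ℓ * (x₁ - x₂) := by rw [← hy]; ring
    have ha' : a = 2 * ℓ * (y₁ - ℓ * x₁) + x₁ * x₂ + (x₁ + x₂) * (ℓ ^ 2 - x₁ - x₂) := by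
      rw [ha, hy₂]
      ring
    refine ⟨ℓ, y₁ - ℓ * x₁, by ring, by linear_combination -hy, ha', ?_, fun _ => hs,
      fun h => absurd h hx, hadd⟩
    linear_combination -e₁ - x₁ * ha'

end Field

namespace Affine.Point

/-- The coordinate `z = -x/y` of a point. -/
def zCoord [Field K] {W : WeierstrassCurve K} : W.toAffine.Point → K
  | .zero => 0
  | .some x y _ => -x / y

/-- The coordinate `w = -1/y` of a point. -/
def wCoord [Field K] {W : WeierstrassCurve K} : W.toAffine.Point → K
  | .zero => 0
  | .some _ y _ => -1 / y

/-- A point lies in the kernel of reduction if it is the point at infinity or its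
`x`-coordinate is not integral. -/
def InKernel [NormedField K] {W : WeierstrassCurve K} : W.toAffine.Point → Prop
  | .zero => True
  | .some x _ _ => 1 < ‖x‖

end Affine.Point

open Affine.Point

variable [NormedField K] [IsUltrametricDist K] {a b : K}

/-- The curve `y² = x³ + ax + b` is integral with good reduction, in residue characteristic
different from `2`. -/
structure GoodCoeffs (a b : K) : Prop where
  a_le : ‖a‖ ≤ 1
  b_le : ‖b‖ ≤ 1
  two : ‖(2 : K)‖ = 1
  disc : ‖4 * a ^ 3 + 27 * b ^ 2‖ = 1

omit [IsUltrametricDist K] in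
lemma GoodCoeffs.two_ne_zero (h : GoodCoeffs a b) : (2 : K) ≠ 0 :=
  norm_ne_zero_iff.mp (by simp [h.two])

omit [IsUltrametricDist K] in
lemma GoodCoeffs.isElliptic (h : GoodCoeffs a b) : (shortCurve a b).IsElliptic := by
  rw [isElliptic_iff, shortCurve_Δ, isUnit_iff_ne_zero, ← norm_ne_zero_iff,
    show (-16 : K) = -2 ^ 4 by norm_num]
  simp [h.two, h.disc]

omit [IsUltrametricDist K] in
lemma GoodCoeffs.nonsingular (h : GoodCoeffs a b) {x y : K} (e : y ^ 2 = x ^ 3 + a * x + b) :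
    (shortCurve a b).toAffine.Nonsingular x y :=
  have := h.isElliptic
  Affine.equation_iff_nonsingular.mp (shortCurve_equation_iff.mpr e)

lemma GoodCoeffs.norm_y_sq (h : GoodCoeffs a b) {x y : K} (e : y ^ 2 = x ^ 3 + a * x + b)
    (hx : 1 < ‖x‖) : ‖y‖ ^ 2 = ‖x‖ ^ 3 := by
  rw [← norm_pow, e, add_assoc, norm_add_eq_left_of_lt, norm_pow]
  have h1 : ‖x‖ < ‖x ^ 3‖ := by
    rw [norm_pow]
    exact lt_self_pow₀ hx (by simp)
  exact norm_add_lt_of_lt_ultra ((norm_mul_le_left h.a_le le_rfl).trans_lt h1)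
    (h.b_le.trans_lt (hx.trans h1))

lemma GoodCoeffs.norm_y_le (h : GoodCoeffs a b) {x y : K} (e : y ^ 2 = x ^ 3 + a * x + b)
    (hx : ‖x‖ ≤ 1) : ‖y‖ ≤ 1 := by
  have h2 : ‖y‖ ^ 2 ≤ 1 := by
    rw [← norm_pow, e]
    refine norm_add_le_of_le_ultra (norm_add_le_of_le_ultra ?_ (norm_mul_le_left h.a_le hx)) h.b_le
    rw [norm_pow]
    exact pow_le_one₀ (norm_nonneg _) hx
  exact (pow_le_one_iff_of_nonneg (norm_nonneg _) (by simp)).mp h2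

lemma GoodCoeffs.y_ne_zero (h : GoodCoeffs a b) {x y : K} (e : y ^ 2 = x ^ 3 + a * x + b)
    (hx : 1 < ‖x‖) : y ≠ 0 := by
  rintro rfl
  have := h.norm_y_sq e hx
  have h3 : 0 < ‖x‖ ^ 3 := by positivity
  simp only [norm_zero, ne_eq, OfNat.ofNat_ne_zero, not_false_eq_true, zero_pow] at this
  exact h3.ne this

/-- Since `x³` dominates, `|y|² = |x|³`; hence `|z| = |x|^(-1/2)` and `|w| = |x|^(-3/2)`. -/
lemma GoodCoeffs.norm_z_w (h : GoodCoeffs a b) {x y : K} (e : y ^ 2 = x ^ 3 + a * x + b)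
    (hx : 1 < ‖x‖) : ‖-x / y‖ < 1 ∧ ‖-1 / y‖ = ‖-x / y‖ ^ 3 := by
  have hy := norm_pos_iff.mpr (h.y_ne_zero e hx)
  have hs := h.norm_y_sq e hx
  have hx0 : 0 < ‖x‖ := zero_lt_one.trans hx
  simp only [norm_div, norm_neg, norm_one]
  constructor
  · rw [div_lt_one hy]
    by_contra! hle
    have := pow_le_pow_left₀ hy.le hle 2
    rw [hs] at this
    exact absurd this (not_le.mpr (pow_lt_pow_right₀ hx (by simp)))
  · rw [div_pow, ← hs]
    field_simp

variable {P Q : (shortCurve a b).toAffine.Point}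

lemma Affine.Point.InKernel.norm_zCoord_lt (h : GoodCoeffs a b) (hP : P.InKernel) :
    ‖P.zCoord‖ < 1 := by
  rcases P with _ | ⟨x, y, hxy⟩
  · simp [zCoord]
  · exact (h.norm_z_w (shortCurve_equation_iff.mp hxy.1) hP).1

lemma Affine.Point.InKernel.norm_wCoord (h : GoodCoeffs a b) (hP : P.InKernel) :
    ‖P.wCoord‖ = ‖P.zCoord‖ ^ 3 := by
  rcases P with _ | ⟨x, y, hxy⟩
  · simp [zCoord, wCoord]
  · exact (h.norm_z_w (shortCurve_equation_iff.mp hxy.1) hP).2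

lemma Affine.Point.InKernel.norm_wCoord_lt (h : GoodCoeffs a b) (hP : P.InKernel) :
    ‖P.wCoord‖ < 1 := by
  rw [hP.norm_wCoord h]
  exact pow_lt_one₀ (norm_nonneg _) (hP.norm_zCoord_lt h) (by simp)

lemma Affine.Point.InKernel.chart_equation (h : GoodCoeffs a b) (hP : P.InKernel) :
    P.wCoord = P.zCoord ^ 3 + a * P.zCoord * P.wCoord ^ 2 + b * P.wCoord ^ 3 := by
  rcases P with _ | ⟨x, y, hxy⟩
  · simp [zCoord, wCoord]
  · have e := shortCurve_equation_iff.mp hxy.1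
    have hy := h.y_ne_zero e hP
    simp only [zCoord, wCoord]
    field_simp
    linear_combination -e

lemma Affine.Point.InKernel.neg {K : Type*} [NormedField K] {a b : K}
    {P : (shortCurve a b).toAffine.Point} (hP : P.InKernel) : (-P).InKernel := by
  rcases P with _ | ⟨x, y, hxy⟩ <;> exact hP

lemma exists_point_of_chart (h : GoodCoeffs a b) {z w : K} (hz : ‖z‖ < 1) (hw : ‖w‖ < 1)
    (e : w = z ^ 3 + a * z * w ^ 2 + b * w ^ 3) :
    ∃ P : (shortCurve a b).toAffine.Point, P.InKernel ∧ P.zCoord = z ∧ P.wCoord = w := by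
  -- The chart equation says that `w` times this unit is `z³`.
  have hu : ‖1 - (a * z * w + b * w ^ 2)‖ = 1 := by
    refine norm_one_sub_eq_one (norm_add_lt_of_lt_ultra ?_ ?_)
    · exact (norm_mul_le_left (norm_mul_le_left h.a_le hz.le) le_rfl).trans_lt hw
    · rw [sq]
      exact (norm_mul_le_left h.b_le (norm_mul_le_left hw.le le_rfl)).trans_lt hw
  have hn : ‖w‖ = ‖z‖ ^ 3 := by
    rw [← norm_pow, show z ^ 3 = w * (1 - (a * z * w + b * w ^ 2)) by linear_combination -e,
      norm_mul, hu, mul_one]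
  rcases eq_or_ne z 0 with rfl | hz0
  · refine ⟨0, trivial, rfl, ?_⟩
    rw [norm_zero, zero_pow (by simp), norm_eq_zero] at hn
    rw [hn]
    rfl
  · have hzn := norm_pos_iff.mpr hz0
    have hw0 : w ≠ 0 := by
      rw [← norm_ne_zero_iff, hn]
      positivity
    have he : (-1 / w) ^ 2 = (z / w) ^ 3 + a * (z / w) + b := by
      field_simp
      linear_combination e
    refine ⟨.some (z / w) (-1 / w) (h.nonsingular he), ?_, ?_, ?_⟩
    · simp only [InKernel, norm_div]
      rw [hn, one_lt_div (by positivity)]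
      exact pow_lt_self_of_lt_one₀ hzn hz (by simp)
    · simp only [zCoord]
      field_simp
    · simp only [wCoord]
      field_simp

variable [DecidableEq K]

/-- The chart formulas hold on the whole kernel of reduction, with no exceptions: the slope is
written without dividing by `z₁ - z₂`, so it also covers tangents, and the point at infinity is the
origin of the chart. -/
lemma Affine.Point.InKernel.add_chart (h : GoodCoeffs a b) (hP : P.InKernel) (hQ : Q.InKernel) :
    (P + Q).InKernel ∧ (P + Q).zCoord = chartAddZ a b P.zCoord P.wCoord Q.zCoord Q.wCoord ∧
      (P + Q).wCoord = chartAddW a b P.zCoord P.wCoord Q.zCoord Q.wCoord := by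
  have hD : ‖chartDen a b P.zCoord P.wCoord Q.wCoord‖ = 1 :=
    norm_chartDen h.a_le h.b_le (hP.norm_zCoord_lt h).le (hP.norm_wCoord_lt h)
      (hQ.norm_wCoord_lt h)
  have hD0 : chartDen a b P.zCoord P.wCoord Q.wCoord ≠ 0 := norm_ne_zero_iff.mp (by simp [hD])
  have hlt := norm_chartAddZ_lt_one h.a_le h.b_le (hP.norm_zCoord_lt h) (hQ.norm_zCoord_lt h)
    (hP.norm_wCoord h).le (hQ.norm_wCoord h).le
  -- if `P = 0`, `Q = 0` or `P + Q = 0`, the line through `P` and `Q` passes through the origin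
  have hfrom0 : ∀ l, chartSlope a b P.zCoord P.wCoord Q.zCoord Q.wCoord = l →
      P.wCoord = l * P.zCoord → chartAddZ a b P.zCoord P.wCoord Q.zCoord Q.wCoord =
        P.zCoord + Q.zCoord ∧ chartAddW a b P.zCoord P.wCoord Q.zCoord Q.wCoord =
        l * (P.zCoord + Q.zCoord) := by
    intro l hl hw
    have hI : chartIntercept a b P.zCoord P.wCoord Q.zCoord Q.wCoord = 0 := by
      rw [chartIntercept, hl, hw, sub_self]
    have hZ : chartAddZ a b P.zCoord P.wCoord Q.zCoord Q.wCoord = P.zCoord + Q.zCoord := by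
      rw [chartAddZ, hI]
      simp
    exact ⟨hZ, by rw [chartAddW, hI, hZ, hl, sub_zero]⟩
  have eP := hP.chart_equation h
  have eQ := hQ.chart_equation h
  rcases P with _ | ⟨x₁, y₁, h₁⟩
  · obtain ⟨hZ, hW⟩ := hfrom0 _ rfl (by simp [zCoord, wCoord])
    rw [hZ, hW, ← zero_def, zero_add]
    refine ⟨hQ, by simp [zCoord], ?_⟩
    rcases eq_or_ne Q.zCoord 0 with h0 | h0
    · have := hQ.norm_wCoord h
      rw [h0] at this ⊢
      simpa [zCoord, zero_def] using this
    · rw [chartSlope, div_mul_eq_mul_div, eq_div_iff (by simpa [zero_def] using hD0)]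
      simp only [zCoord, wCoord, chartDen] at eP eQ ⊢
      linear_combination eQ
  · rcases Q with _ | ⟨x₂, y₂, h₂⟩
    · have hz0 : (some x₁ y₁ h₁).zCoord ≠ 0 := by
        have hx : x₁ ≠ 0 := norm_pos_iff.mp (zero_lt_one.trans hP)
        simp [zCoord, hx, h.y_ne_zero (shortCurve_equation_iff.mp h₁.1) hP]
      obtain ⟨hZ, hW⟩ := hfrom0 ((some x₁ y₁ h₁).wCoord / (some x₁ y₁ h₁).zCoord) (by
        rw [chartSlope, div_eq_div_iff hD0 hz0]
        simp only [chartDen]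
        simp only [zCoord, wCoord] at eP ⊢
        linear_combination -eP) (by field_simp)
      rw [hZ, hW, ← zero_def, add_zero]
      refine ⟨hP, by simp [zCoord], ?_⟩
      rw [show (0 : (shortCurve a b).toAffine.Point).zCoord = 0 from rfl, add_zero]
      field_simp
    · have e₁ := shortCurve_equation_iff.mp h₁.1
      have e₂ := shortCurve_equation_iff.mp h₂.1
      have hy₁ := h.y_ne_zero e₁ hP
      have hy₂ := h.y_ne_zero e₂ hQ
      by_cases hxy : x₁ = x₂ ∧ y₁ = -y₂
      · have hz0 : (some x₁ y₁ h₁).zCoord ≠ 0 := by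
          have hx : x₁ ≠ 0 := norm_pos_iff.mp (zero_lt_one.trans hP)
          simp [zCoord, hx, hy₁]
        have hzz : (some x₂ y₂ h₂).zCoord = -(some x₁ y₁ h₁).zCoord := by
          simp [zCoord, hxy.1, hxy.2, div_neg, neg_div]
        have hww : (some x₂ y₂ h₂).wCoord = -(some x₁ y₁ h₁).wCoord := by
          simp [wCoord, hxy.2, div_neg, neg_div]
        obtain ⟨hZ, hW⟩ := hfrom0 ((some x₁ y₁ h₁).wCoord / (some x₁ y₁ h₁).zCoord) (by
          rw [chartSlope, div_eq_div_iff hD0 hz0, hww, hzz]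
          simp only [chartDen]
          linear_combination -eP) (by field_simp)
        rw [hZ, hW, add_of_Y_eq hxy.1 (by rw [shortCurve_negY]; exact hxy.2), hzz]
        refine ⟨trivial, ?_, ?_⟩ <;> simp [zCoord, wCoord]
      · obtain ⟨ℓ, m, l₁, l₂, ha, hb, -, -, h₃, hadd⟩ :=
          exists_line_add h.two_ne_zero h₁ h₂ hxy
        have hE : chartLead a b (chartSlope a b (some x₁ y₁ h₁).zCoord (some x₁ y₁ h₁).wCoord
            (some x₂ y₂ h₂).zCoord (some x₂ y₂ h₂).wCoord) ≠ 0 := by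
          rw [← norm_ne_zero_iff, norm_chartLead h.a_le h.b_le]
          · exact one_ne_zero
          · obtain ⟨r, hr0, hr, k₁, k₂⟩ : ∃ r : ℝ, 0 ≤ r ∧ r < 1 ∧ ‖(some x₁ y₁ h₁).zCoord‖ ≤ r ∧
                ‖(some x₂ y₂ h₂).zCoord‖ ≤ r :=
              ⟨max ‖(some x₁ y₁ h₁).zCoord‖ ‖(some x₂ y₂ h₂).zCoord‖,
                le_max_of_le_left (norm_nonneg _),
                max_lt (hP.norm_zCoord_lt h) (hQ.norm_zCoord_lt h), le_max_left _ _,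
                le_max_right _ _⟩
            have hc : ∀ {R : (shortCurve a b).toAffine.Point}, R.InKernel → ‖R.zCoord‖ ≤ r →
                ‖R.wCoord‖ ≤ r := fun hR hr' => by
              rw [hR.norm_wCoord h]
              exact (pow_le_of_le_one (norm_nonneg _) (hr'.trans hr.le) (by simp)).trans hr'
            exact (norm_chartSlope_le h.a_le h.b_le hr k₁ k₂ (hc hP k₁) (hc hQ k₂)).trans_lt
              (pow_lt_one₀ hr0 hr (by simp))
        obtain ⟨h0, hZ, hW⟩ := chartAdd_of_line (l₁ ▸ hy₁) (l₂ ▸ hy₂) ha hb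
          (by rw [← l₁]; rfl) (by rw [← l₁]; rfl) (by rw [← l₂]; rfl) (by rw [← l₂]; rfl) hD0 hE
        rw [hadd]
        refine ⟨?_, hZ, hW⟩
        have e₃ := shortCurve_equation_iff.mp h₃.1
        -- If `x₃` were integral, so would be `y₃`, whereas `|w₃| = 1/|y₃| < 1`.
        by_contra hx₃
        have hy₃ := h.norm_y_le e₃ (not_lt.mp hx₃)
        have := hlt.2
        rw [← hW, norm_div, norm_neg, norm_one, div_lt_one (norm_pos_iff.mpr (neg_ne_zero.mpr h0))] at this
        exact absurd hy₃ (not_le.mpr this)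

end ShortCurve

/-! ### Multiplication by `n` on the kernel of reduction. -/

section Kernel

open Affine.Point

variable {K : Type*} [NormedField K] [IsUltrametricDist K] [DecidableEq K] {a b : K} {r : ℝ}
  {P Q : (shortCurve a b).toAffine.Point}

lemma Affine.Point.InKernel.add (h : GoodCoeffs a b) (hP : P.InKernel) (hQ : Q.InKernel) :
    (P + Q).InKernel := (hP.add_chart h hQ).1

lemma Affine.Point.InKernel.sub (h : GoodCoeffs a b) (hP : P.InKernel) (hQ : Q.InKernel) :
    (P - Q).InKernel := by
  rw [sub_eq_add_neg]
  exact hP.add h hQ.neg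

lemma Affine.Point.InKernel.nsmul (h : GoodCoeffs a b) (hP : P.InKernel) (n : ℕ) :
    (n • P).InKernel := by
  induction n with
  | zero => rw [zero_nsmul]; trivial
  | succ n ih => rw [succ_nsmul]; exact ih.add h hP

lemma Affine.Point.InKernel.norm_zCoord_add_sub_le (h : GoodCoeffs a b) (hP : P.InKernel)
    (hQ : Q.InKernel) (hr : r < 1) (hPr : ‖P.zCoord‖ ≤ r) (hQr : ‖Q.zCoord‖ ≤ r) :
    ‖(P + Q).zCoord - P.zCoord - Q.zCoord‖ ≤ r ^ 4 * ‖P.zCoord‖ := by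
  rw [(hP.add_chart h hQ).2.1]
  refine norm_chartAddZ_sub_le h.a_le h.b_le hr hPr hQr (hP.norm_wCoord h).le ?_
  rw [hQ.norm_wCoord h]
  exact (pow_le_of_le_one (norm_nonneg _) (hQr.trans hr.le) (by simp)).trans hQr

/-- This is `[n]z = nz + O(z⁵)`. Each addition of `P` contributes an error of at most `‖z‖⁵`, and
ultrametric errors do not accumulate. -/
lemma Affine.Point.InKernel.norm_zCoord_nsmul_sub_le (h : GoodCoeffs a b) (hP : P.InKernel)
    (n : ℕ) : ‖(n • P).zCoord - n * P.zCoord‖ ≤ ‖P.zCoord‖ ^ 5 ∧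
      ‖(n • P).zCoord‖ ≤ ‖P.zCoord‖ := by
  have hr := hP.norm_zCoord_lt h
  have h5 : ‖P.zCoord‖ ^ 5 ≤ ‖P.zCoord‖ := pow_le_of_le_one (norm_nonneg _) hr.le (by simp)
  have hle : ∀ n : ℕ, ‖(n • P).zCoord - n * P.zCoord‖ ≤ ‖P.zCoord‖ ^ 5 →
      ‖(n • P).zCoord‖ ≤ ‖P.zCoord‖ := fun n hn => by
    rw [← sub_add_cancel (n • P).zCoord (n * P.zCoord)]
    exact norm_add_le_of_le_ultra (hn.trans h5)
      (norm_mul_le_left (IsUltrametricDist.norm_natCast_le_one K n) le_rfl)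
  refine ⟨?_, hle n ?_⟩ <;>
  · induction n with
    | zero => simp [zCoord, zero_def]
    | succ n ih =>
      have := hP.norm_zCoord_add_sub_le h (hP.nsmul h n) hr le_rfl (hle n ih)
      rw [← pow_succ] at this
      rw [succ_nsmul', show (P + n • P).zCoord - ((n + 1 : ℕ) : K) * P.zCoord =
        ((P + n • P).zCoord - P.zCoord - (n • P).zCoord) +
          ((n • P).zCoord - n * P.zCoord) by push_cast; ring]
      exact norm_add_le_of_le_ultra this ih

omit [DecidableEq K] in
lemma Affine.Point.InKernel.eq_zero_of_zCoord (h : GoodCoeffs a b) (hP : P.InKernel)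
    (hz : P.zCoord = 0) : P = 0 := by
  rcases P with _ | ⟨x, y, hxy⟩
  · rfl
  · have hx : x ≠ 0 := norm_pos_iff.mp (zero_lt_one.trans hP)
    exact absurd hz (by simp [zCoord, hx, h.y_ne_zero (shortCurve_equation_iff.mp hxy.1) hP])

/-- Applied to `P = (P - Q) + Q`, the addition estimate has an error strictly smaller than `z(P -
Q)` unless the latter vanishes. So `z` is an isometry from the kernel of reduction. -/
lemma Affine.Point.InKernel.norm_zCoord_sub (h : GoodCoeffs a b) (hP : P.InKernel)
    (hQ : Q.InKernel) : ‖(P - Q).zCoord‖ = ‖P.zCoord - Q.zCoord‖ := by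
  have hD := hP.sub h hQ
  obtain ⟨r, hr0, hr, k₁, k₂⟩ : ∃ r : ℝ, 0 ≤ r ∧ r < 1 ∧ ‖(P - Q).zCoord‖ ≤ r ∧ ‖Q.zCoord‖ ≤ r :=
    ⟨max ‖(P - Q).zCoord‖ ‖Q.zCoord‖, le_max_of_le_left (norm_nonneg _),
      max_lt (hD.norm_zCoord_lt h) (hQ.norm_zCoord_lt h), le_max_left _ _, le_max_right _ _⟩
  have he := hD.norm_zCoord_add_sub_le h hQ hr k₁ k₂
  rw [sub_add_cancel, sub_right_comm] at he
  rcases eq_or_ne (P - Q).zCoord 0 with h0 | h0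
  · rw [h0, norm_zero, mul_zero, sub_zero] at he
    rw [h0, norm_zero]
    exact (norm_nonneg _).antisymm he
  · refine (norm_eq_of_norm_sub_lt (he.trans_lt ?_)).symm
    exact mul_lt_of_lt_one_left (norm_pos_iff.mpr h0) (pow_lt_one₀ hr0 hr (by simp))

lemma Affine.Point.InKernel.ext_zCoord (h : GoodCoeffs a b) (hP : P.InKernel)
    (hQ : Q.InKernel) (hz : P.zCoord = Q.zCoord) : P = Q := by
  rw [← sub_eq_zero]
  refine (hP.sub h hQ).eq_zero_of_zCoord h ?_
  rw [← norm_eq_zero, hP.norm_zCoord_sub h hQ, hz, sub_self, norm_zero]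

-- For fixed `z`, the chart equation is a fixed-point equation for `w`, and its right-hand side
-- contracts the ball of radius `‖z‖` by the factor `‖z‖`.
omit [DecidableEq K] in
lemma exists_point_of_zCoord [CompleteSpace K] (h : GoodCoeffs a b) {z : K} (hz : ‖z‖ < 1) :
    ∃ P : (shortCurve a b).toAffine.Point, P.InKernel ∧ P.zCoord = z := by
  have hball : ∀ {s t : K}, ‖s‖ ≤ ‖z‖ → ‖t‖ ≤ ‖z‖ → ‖s * t‖ ≤ ‖z‖ := fun hs ht =>
    norm_mul_le_left (hs.trans hz.le) ht
  obtain ⟨w, hw, e⟩ := exists_fixedPoint_of_contracting (norm_nonneg z) hz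
    (fun w => z ^ 3 + a * z * w ^ 2 + b * w ^ 3)
    (fun t ht => by
      simp only [pow_succ, pow_zero, one_mul]
      refine norm_add_le_of_le_ultra (norm_add_le_of_le_ultra ?_ ?_) ?_
      · exact hball (hball le_rfl le_rfl) le_rfl
      · exact hball (norm_mul_le_left h.a_le le_rfl) (hball ht ht)
      · exact norm_mul_le_left h.b_le (hball (hball ht ht) ht))
    (fun s t hs ht => by
      rw [show z ^ 3 + a * z * s ^ 2 + b * s ^ 3 - (z ^ 3 + a * z * t ^ 2 + b * t ^ 3) =
        (a * (z * (s + t)) + b * (s * s + s * t + t * t)) * (s - t) by ring, norm_mul]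
      gcongr
      refine norm_add_le_of_le_ultra (norm_mul_le_left h.a_le (hball le_rfl ?_))
        (norm_mul_le_left h.b_le ?_)
      · exact norm_add_le_of_le_ultra hs ht
      · exact norm_add_le_of_le_ultra (norm_add_le_of_le_ultra (hball hs hs) (hball hs ht))
          (hball ht ht))
  obtain ⟨P, hP, hPz, -⟩ := exists_point_of_chart h hz (hw.trans_lt hz) e.symm
  exact ⟨P, hP, hPz⟩

/-- Newton iteration with the constant derivative `n`: the map `t ↦ t - ([n]t - z(Q))/n` preserves
the ball of radius `|n|`. There `[n]s - [n]t` differs from `n(s - t)` by at most `|n|⁴|s - t|`, so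
the contraction factor is `|n|³`. -/
lemma exists_nsmul_eq_of_inKernel [CompleteSpace K] (h : GoodCoeffs a b) {n : ℕ}
    (hn0 : (n : K) ≠ 0) (hn1 : ‖(n : K)‖ < 1) (hQ : Q.InKernel)
    (hQz : ‖Q.zCoord‖ ≤ ‖(n : K)‖ ^ 2) :
    ∃ P : (shortCurve a b).toAffine.Point, P.InKernel ∧ ‖P.zCoord‖ ≤ ‖(n : K)‖ ∧ n • P = Q := by
  have hpos := norm_pos_iff.mpr hn0
  set c := ‖(n : K)‖ with hc
  have hσ : ∀ t : K, ∃ P : (shortCurve a b).toAffine.Point,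
      P.InKernel ∧ (‖t‖ ≤ c → P.zCoord = t) := fun t => by
    by_cases ht : ‖t‖ ≤ c
    · obtain ⟨P, hP, hPz⟩ := exists_point_of_zCoord h (ht.trans_lt hn1)
      exact ⟨P, hP, fun _ => hPz⟩
    · exact ⟨0, trivial, fun h => absurd h ht⟩
  choose σ hσk hσz using hσ
  obtain ⟨t, ht, hft⟩ := exists_fixedPoint_of_contracting hpos.le
    (pow_lt_one₀ hpos.le hn1 (n := 3) (by simp))
    (fun t => t - ((n • σ t).zCoord - Q.zCoord) / n)
    (fun t ht => by
      have h5 := ((hσk t).norm_zCoord_nsmul_sub_le h n).1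
      rw [hσz t ht] at h5
      rw [show t - ((n • σ t).zCoord - Q.zCoord) / n =
        (Q.zCoord - ((n • σ t).zCoord - n * t)) / n by field_simp; ring, norm_div,
        div_le_iff₀ hpos, ← sq]
      refine norm_sub_le_of_le_ultra hQz (h5.trans ?_)
      calc ‖t‖ ^ 5 ≤ c ^ 5 := by gcongr
        _ ≤ c ^ 2 := pow_le_pow_of_le_one hpos.le hn1.le (by simp))
    (fun s t hs ht => by
      have hD := (hσk s).sub h (hσk t)
      have hDz : ‖(σ s - σ t).zCoord‖ = ‖s - t‖ := by
        rw [(hσk s).norm_zCoord_sub h (hσk t), hσz s hs, hσz t ht]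
      have hDc : ‖(σ s - σ t).zCoord‖ ≤ c := by
        rw [hDz]
        exact norm_sub_le_of_le_ultra hs ht
      obtain ⟨e₂, hnD⟩ := hD.norm_zCoord_nsmul_sub_le h n
      have e₁ := (hD.nsmul h n).norm_zCoord_add_sub_le h ((hσk t).nsmul h n) hn1
        (hnD.trans hDc) (((hσk t).norm_zCoord_nsmul_sub_le h n).2.trans (by rwa [hσz t ht]))
      have e₃ := hD.norm_zCoord_add_sub_le h (hσk t) hn1 hDc (by rwa [hσz t ht])
      rw [← nsmul_add] at e₁
      rw [sub_add_cancel] at e₁ e₃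
      rw [hσz s hs, hσz t ht] at e₃
      -- With `D = σ s - σ t`, the three terms are the errors of additivity of `z` for `D + σ t` and
      -- for `nD + nσ t`, and the error of `[n]z ≈ nz` at `D`.
      have hsplit : s - ((n • σ s).zCoord - Q.zCoord) / n -
          (t - ((n • σ t).zCoord - Q.zCoord) / n) =
          (n * (s - (σ s - σ t).zCoord - t) -
            ((n • σ s).zCoord - (n • (σ s - σ t)).zCoord - (n • σ t).zCoord) -
            ((n • (σ s - σ t)).zCoord - n * (σ s - σ t).zCoord)) / n := by
        field_simp
        ring
      rw [hsplit, norm_div, div_le_iff₀ hpos, ← hDz,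
        show c ^ 3 * ‖(σ s - σ t).zCoord‖ * c = c ^ 4 * ‖(σ s - σ t).zCoord‖ by ring]
      refine norm_sub_le_of_le_ultra (norm_sub_le_of_le_ultra
        (norm_mul_le_left hn1.le e₃) (e₁.trans ?_)) (e₂.trans ?_)
      · gcongr
      · rw [pow_succ]
        gcongr)
  refine ⟨σ t, hσk t, (hσz t ht).symm ▸ ht, ((hσk t).nsmul h n).ext_zCoord h hQ ?_⟩
  have : ((n • σ t).zCoord - Q.zCoord) / n = 0 := by simpa using hft
  rw [div_eq_zero_iff, or_iff_left hn0] at this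
  exact sub_eq_zero.mp this

/-- From `0 = nz + O(z⁵)` with `z ≠ 0` follows `|n| ≤ |z|⁴`, which is incompatible with `|z| ≤ |n| <
1`. -/
lemma Affine.Point.InKernel.norm_lt_of_nsmul_eq_zero (h : GoodCoeffs a b) {n : ℕ}
    (hn0 : (n : K) ≠ 0) (hn1 : ‖(n : K)‖ < 1) (hP : P.InKernel) (hP0 : P ≠ 0)
    (hnP : n • P = 0) : ‖(n : K)‖ < ‖P.zCoord‖ := by
  by_contra! hle
  have hz : 0 < ‖P.zCoord‖ := norm_pos_iff.mpr fun h0 => hP0 (hP.eq_zero_of_zCoord h h0)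
  have h5 := (hP.norm_zCoord_nsmul_sub_le h n).1
  rw [hnP, show (0 : (shortCurve a b).toAffine.Point).zCoord = 0 from rfl, zero_sub, norm_neg,
    norm_mul, pow_succ] at h5
  have h4 := le_of_mul_le_mul_right h5 hz
  have : ‖P.zCoord‖ ^ 4 ≤ ‖(n : K)‖ ^ 4 := by gcongr
  exact absurd (h4.trans this)
    (not_le.mpr (pow_lt_self_of_lt_one₀ (norm_pos_iff.mpr hn0) hn1 (by simp)))

end Kernel

/-! ### Congruent points on congruent curves. -/

section Congruence

open Affine.Point

variable {K : Type*} [NormedField K] [IsUltrametricDist K] {a b a' b' : K} {ε : ℝ}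

/-- Keep `z` and solve again for `w`. Subtracting the chart equations expresses `w - w'` times a
unit as a combination of `a - a'` and `b - b'`. -/
lemma exists_congruent_point_of_inKernel [CompleteSpace K] (h : GoodCoeffs a b)
    (h' : GoodCoeffs a' b') (ha : IntegralCong ε a a') (hb : IntegralCong ε b b')
    {P : (shortCurve a b).toAffine.Point} (hP : P.InKernel) :
    ∃ P' : (shortCurve a' b').toAffine.Point, P'.InKernel ∧ P'.zCoord = P.zCoord ∧
      IntegralCong ε P.wCoord P'.wCoord := by
  have hz := hP.norm_zCoord_lt h
  have hw := hP.norm_wCoord_lt h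
  obtain ⟨P', hP', hzz⟩ := exists_point_of_zCoord h' hz
  have hw' := hP'.norm_wCoord_lt h'
  refine ⟨P', hP', hzz, hw.le, hw'.le, ?_⟩
  have e := hP.chart_equation h
  have e' := hP'.chart_equation h'
  rw [hzz] at e'
  have hD := norm_chartDen h'.a_le h'.b_le hz.le hw hw'
  have : (P.wCoord - P'.wCoord) * chartDen a' b' P.zCoord P.wCoord P'.wCoord =
      (a - a') * (P.zCoord * P.wCoord ^ 2) + (b - b') * P.wCoord ^ 3 := by
    rw [chartDen]
    linear_combination e - e'
  rw [← mul_one ‖P.wCoord - P'.wCoord‖, ← hD, ← norm_mul, this]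
  have hpow : ∀ n : ℕ, ‖P.wCoord ^ n‖ ≤ 1 := fun n => by
    rw [norm_pow]
    exact pow_le_one₀ (norm_nonneg _) hw.le
  exact norm_add_le_of_le_ultra (norm_mul_le_right ha.sub (norm_mul_le_left hz.le (hpow 2)))
    (norm_mul_le_right hb.sub (hpow 3))

variable [DecidableEq K]

lemma integralCong_nsmul_of_inKernel (hε : 0 ≤ ε) (h : GoodCoeffs a b)
    (h' : GoodCoeffs a' b') (ha : IntegralCong ε a a') (hb : IntegralCong ε b b')
    {P : (shortCurve a b).toAffine.Point} (hP : P.InKernel)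
    {P' : (shortCurve a' b').toAffine.Point} (hP' : P'.InKernel)
    (hz : IntegralCong ε P.zCoord P'.zCoord) (hw : IntegralCong ε P.wCoord P'.wCoord) (n : ℕ) :
    IntegralCong ε (n • P).zCoord (n • P').zCoord ∧
      IntegralCong ε (n • P).wCoord (n • P').wCoord := by
  induction n with
  | zero =>
    rw [zero_nsmul, zero_nsmul]
    exact ⟨.refl hε (by simp [zCoord]), .refl hε (by simp [wCoord])⟩
  | succ n ih =>
    have k := hP.nsmul h n
    have k' := hP'.nsmul h' n
    rw [succ_nsmul, succ_nsmul, (k.add_chart h hP).2.1, (k'.add_chart h' hP').2.1,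
      (k.add_chart h hP).2.2, (k'.add_chart h' hP').2.2]
    exact integralCong_chartAdd hε ha hb ih.1 ih.2 hz hw (k.norm_zCoord_lt h)
      (hP.norm_zCoord_lt h) (k.norm_wCoord_lt h) (hP.norm_wCoord_lt h) (k'.norm_zCoord_lt h')
      (hP'.norm_zCoord_lt h') (k'.norm_wCoord_lt h') (hP'.norm_wCoord_lt h')

-- A slope of norm greater than 1 dominates: `|x₃| = |ℓ|²` and `|y₃| = |ℓ|³`.
omit [DecidableEq K] in
lemma add_inKernel_of_norm_slope (h : GoodCoeffs a b) {x₁ x₂ ℓ y₃ : K}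
    (hx₁ : ‖x₁‖ ≤ 1) (hx₂ : ‖x₂‖ ≤ 1) (hℓ : 1 < ‖ℓ‖)
    (h₃ : (shortCurve a b).toAffine.Nonsingular (ℓ ^ 2 - x₁ - x₂) y₃) :
    (some _ _ h₃).InKernel ∧ ‖(some _ _ h₃).zCoord‖ = ‖ℓ‖⁻¹ := by
  have hℓ2 : 1 < ‖ℓ ^ 2‖ := by
    rw [norm_pow]
    exact one_lt_pow₀ hℓ (by simp)
  have hx₃ : ‖ℓ ^ 2 - x₁ - x₂‖ = ‖ℓ‖ ^ 2 := by
    rw [sub_sub, sub_eq_add_neg, norm_add_eq_left_of_lt, norm_pow]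
    rw [norm_neg]
    exact (norm_add_le_of_le_ultra hx₁ hx₂).trans_lt hℓ2
  have hk : (some _ _ h₃).InKernel := by
    simp only [InKernel]
    rwa [hx₃, ← norm_pow]
  refine ⟨hk, ?_⟩
  have hy := h.norm_y_sq (shortCurve_equation_iff.mp h₃.1) hk
  rw [hx₃, ← pow_mul, mul_comm 2 3, pow_mul,
    pow_left_inj₀ (norm_nonneg _) (by positivity) (by simp)] at hy
  simp only [zCoord, norm_div, norm_neg, hx₃, hy]
  have : ‖ℓ‖ ≠ 0 := (zero_lt_one.trans hℓ).ne'
  field_simp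

/-- The reductions have the same `x` and different `y`, so they are opposite. The chord has slope of
norm `1/|x₁ - x₂|`, which gives the sharp bound on `z` and not merely membership in the kernel. -/
lemma add_inKernel_of_congruent_neg (h : GoodCoeffs a b) (hε : ε < 1) {x₁ y₁ x₂ y₂ : K}
    (h₁ : (shortCurve a b).toAffine.Nonsingular x₁ y₁)
    (h₂ : (shortCurve a b).toAffine.Nonsingular x₂ y₂) (hx₁ : ‖x₁‖ ≤ 1) (hx₂ : ‖x₂‖ ≤ 1)
    (hx : ‖x₁ - x₂‖ ≤ ε) (hy : ‖y₁ - y₂‖ = 1) :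
    (some _ _ h₁ + some _ _ h₂).InKernel ∧ ‖(some _ _ h₁ + some _ _ h₂).zCoord‖ ≤ ε := by
  by_cases hxy : x₁ = x₂ ∧ y₁ = -y₂
  · rw [add_of_Y_eq hxy.1 (by rw [shortCurve_negY]; exact hxy.2)]
    exact ⟨trivial, by simpa [zero_def, zCoord] using (norm_nonneg _).trans hx⟩
  · obtain ⟨ℓ, m, -, -, -, -, hne, heq, h₃, hadd⟩ := exists_line_add h.two_ne_zero h₁ h₂ hxy
    rcases eq_or_ne x₁ x₂ with hx12 | hx12
    · rw [(heq hx12).1] at hy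
      simp at hy
    · have hℓ : ‖ℓ‖ = ‖x₁ - x₂‖⁻¹ := by rw [hne hx12, norm_div, hy, one_div]
      have hpos : 0 < ‖x₁ - x₂‖ := norm_pos_iff.mpr (sub_ne_zero.mpr hx12)
      obtain ⟨hk, hz⟩ := add_inKernel_of_norm_slope h hx₁ hx₂
        (by rw [hℓ]; exact (one_lt_inv₀ hpos).mpr (hx.trans_lt hε)) h₃
      rw [hadd]
      exact ⟨hk, by rwa [hz, hℓ, inv_inv]⟩

/-- The point reduces to a 2-torsion point. Good reduction makes `3x² + a` a unit, so the tangent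
slope has norm greater than 1. -/
lemma add_self_inKernel (h : GoodCoeffs a b) {x y : K}
    (h₁ : (shortCurve a b).toAffine.Nonsingular x y) (hx : ‖x‖ ≤ 1) (hy : ‖y‖ < 1) :
    (some _ _ h₁ + some _ _ h₁).InKernel := by
  by_cases hxy : x = x ∧ y = -y
  · rw [add_of_Y_eq hxy.1 (by rw [shortCurve_negY]; exact hxy.2)]
    trivial
  · obtain ⟨ℓ, m, -, -, -, -, -, heq, h₃, hadd⟩ := exists_line_add h.two_ne_zero h₁ h₁ hxy
    obtain ⟨-, hy0, hℓ⟩ := heq rfl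
    have e := shortCurve_equation_iff.mp h₁.1
    have hn : ‖3 * x ^ 2 + a‖ = 1 := by
      have hx2 : ‖x ^ 2‖ ≤ 1 := by
        rw [norm_pow]
        exact pow_le_one₀ (norm_nonneg _) hx
      have hle : ‖3 * x ^ 2 + a‖ ≤ 1 :=
        norm_add_le_of_le_ultra (norm_mul_le_left (norm_ofNat_le_one 3) hx2) h.a_le
      by_contra hne
      have hlt := lt_of_le_of_ne hle hne
      -- The discriminant as a combination of `f'(x)` and `f(x) = y²`, where `f = x³ + ax + b`.
      have hd : 4 * a ^ 3 + 27 * b ^ 2 = (6 * (a * x ^ 2) - 9 * (b * x) + 4 * (a * a)) *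
          (3 * x ^ 2 + a) - (18 * (a * x) - 27 * b) * y * y := by
        linear_combination -(27 * b - 18 * a * x) * e
      have := h.disc
      rw [hd] at this
      refine absurd this (ne_of_lt (norm_sub_lt_of_lt_ultra ?_ ?_))
      · refine (norm_mul_le_left (norm_add_le_of_le_ultra (norm_sub_le_of_le_ultra ?_ ?_) ?_)
          le_rfl).trans_lt hlt
        · exact norm_mul_le_left (norm_ofNat_le_one 6) (norm_mul_le_left h.a_le hx2)
        · exact norm_mul_le_left (norm_ofNat_le_one 9) (norm_mul_le_left h.b_le hx)
        · exact norm_mul_le_left (norm_ofNat_le_one 4) (norm_mul_le_left h.a_le h.a_le)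
      · refine (norm_mul_le_left (norm_mul_le_left (norm_sub_le_of_le_ultra ?_ ?_) hy.le)
          le_rfl).trans_lt hy
        · exact norm_mul_le_left (norm_ofNat_le_one 18) (norm_mul_le_left h.a_le hx)
        · exact norm_mul_le_left (norm_ofNat_le_one 27) h.b_le
    have hl : 1 < ‖ℓ‖ := by
      rw [hℓ, norm_div, hn, norm_mul, h.two, one_mul, one_div]
      exact (one_lt_inv₀ (norm_pos_iff.mpr hy0)).mpr hy
    rw [hadd]
    exact (add_inKernel_of_norm_slope h hx hx hl h₃).1

/-- Either alternative in `hne` makes the denominator of the slope a unit on both curves, for a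
chord or for a tangent; the affine formulas then preserve congruences. -/
lemma integralCong_add (hε : 0 ≤ ε) (h : GoodCoeffs a b) (h' : GoodCoeffs a' b')
    (ha : IntegralCong ε a a') {x₁ y₁ x₂ y₂ x₁' y₁' x₂' y₂' : K}
    (h₁ : (shortCurve a b).toAffine.Nonsingular x₁ y₁)
    (h₂ : (shortCurve a b).toAffine.Nonsingular x₂ y₂)
    (h₁' : (shortCurve a' b').toAffine.Nonsingular x₁' y₁')
    (h₂' : (shortCurve a' b').toAffine.Nonsingular x₂' y₂')
    (hx₁ : IntegralCong ε x₁ x₁') (hy₁ : IntegralCong ε y₁ y₁') (hx₂ : IntegralCong ε x₂ x₂')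
    (hy₂ : IntegralCong ε y₂ y₂')
    (hne : (‖x₁ - x₂‖ = 1 ∧ ‖x₁' - x₂'‖ = 1) ∨
      ((x₁ = x₂ ∧ y₁ = y₂ ∧ ‖y₁‖ = 1) ∧ (x₁' = x₂' ∧ y₁' = y₂' ∧ ‖y₁'‖ = 1))) :
    ∃ x₃ y₃ h₃ x₃' y₃' h₃', some x₁ y₁ h₁ + some x₂ y₂ h₂ = some x₃ y₃ h₃ ∧
      some x₁' y₁' h₁' + some x₂' y₂' h₂' = some x₃' y₃' h₃' ∧ IntegralCong ε x₃ x₃' ∧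
      IntegralCong ε y₃ y₃' := by
  have hnd : ∀ {a b : K}, GoodCoeffs a b → ∀ {x₁ y₁ x₂ y₂ : K}, (‖x₁ - x₂‖ = 1 ∨
      (x₁ = x₂ ∧ y₁ = y₂ ∧ ‖y₁‖ = 1)) → ¬(x₁ = x₂ ∧ y₁ = -y₂) := by
    rintro a b h x₁ y₁ x₂ y₂ (hx | ⟨hx, rfl, hy⟩) ⟨hx', hy'⟩
    · simp [hx'] at hx
    · have : 2 * y₁ = 0 := by linear_combination hy'
      rcases mul_eq_zero.mp this with h2 | h2
      · exact h.two_ne_zero h2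
      · simp [h2] at hy
  obtain ⟨ℓ, m, l₁, -, -, -, k₁, k₂, h₃, hadd⟩ := exists_line_add h.two_ne_zero h₁ h₂
    (hnd h (hne.imp And.left And.left))
  obtain ⟨ℓ', m', l₁', -, -, -, k₁', k₂', h₃', hadd'⟩ := exists_line_add h'.two_ne_zero h₁' h₂'
    (hnd h' (hne.imp And.right And.right))
  have two : IntegralCong ε (2 : K) 2 := .refl hε (norm_ofNat_le_one 2)
  have three : IntegralCong ε (3 : K) 3 := .refl hε (norm_ofNat_le_one 3)
  have hℓ : IntegralCong ε ℓ ℓ' := by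
    rcases hne with ⟨hx, hx'⟩ | ⟨⟨hx, -, hy⟩, ⟨hx', -, hy'⟩⟩
    · rw [k₁ fun h => by simp [h] at hx, k₁' fun h => by simp [h] at hx']
      exact (hy₁.diff hy₂).div (hx₁.diff hx₂) hx hx'
    · rw [(k₂ hx).2.2, (k₂' hx').2.2]
      exact ((three.mul (hx₁.pow hε 2)).add ha).div (two.mul hy₁) (by simp [h.two, hy])
        (by simp [h.two, hy'])
  have hm : IntegralCong ε m m' := by
    rw [show m = y₁ - ℓ * x₁ by rw [l₁]; ring, show m' = y₁' - ℓ' * x₁' by rw [l₁']; ring]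
    exact hy₁.diff (hℓ.mul hx₁)
  have hx₃ := ((hℓ.pow hε 2).diff hx₁).diff hx₂
  exact ⟨_, _, h₃, _, _, h₃', hadd, hadd', hx₃, ((hℓ.mul hx₃).add hm).neg⟩

end Congruence

/-! ### Deforming a point of order `p` to a congruent curve. -/

section Torsion

open Affine.Point

variable {K : Type*} [NormedField K] [IsUltrametricDist K] [DecidableEq K] {a b a' b' : K} {ε : ℝ}

-- Hensel's lemma for square roots of units: `y' = y + t`, where `t` is a fixed point of `t ↦ (c -
-- y² - t²)/(2y)`.
omit [DecidableEq K] in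
lemma exists_sq_of_congruent [CompleteSpace K] {y c : K} (h2 : ‖(2 : K)‖ = 1) (hy : ‖y‖ = 1)
    (hε : ε < 1) (hc : ‖c - y ^ 2‖ ≤ ε) : ∃ y', y' ^ 2 = c ∧ ‖y - y'‖ ≤ ε := by
  have h2y : ‖2 * y‖ = 1 := by rw [norm_mul, h2, hy, mul_one]
  have h2y0 : 2 * y ≠ 0 := norm_ne_zero_iff.mp (by simp [h2y])
  obtain ⟨t, ht, hft⟩ := exists_fixedPoint_of_contracting ((norm_nonneg _).trans hc) hε
    (fun t => (c - y ^ 2 - t * t) / (2 * y))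
    (fun t ht => by
      rw [norm_div, h2y, div_one]
      exact norm_sub_le_of_le_ultra hc (norm_mul_le_left (ht.trans hε.le) ht))
    (fun s t hs ht => by
      rw [← sub_div, norm_div, h2y, div_one,
        show c - y ^ 2 - s * s - (c - y ^ 2 - t * t) = -(s + t) * (s - t) by ring, norm_mul,
        norm_neg]
      gcongr
      exact norm_add_le_of_le_ultra hs ht)
  rw [div_eq_iff h2y0] at hft
  refine ⟨y + t, by linear_combination -hft, ?_⟩
  rwa [sub_add_cancel_left, norm_neg]

variable {p : ℕ}

/-- With `km ≡ 1` modulo `p`, the point `P = m(kP)` would lie in the kernel along with `kP`. -/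
lemma not_inKernel_nsmul_of_coprime (h : GoodCoeffs a b) {P : (shortCurve a b).toAffine.Point}
    (hP : ¬P.InKernel) (hpP : p • P = 0) (hp : 1 < p) {k : ℕ} (hk : k.Coprime p) :
    ¬(k • P).InKernel := by
  intro hkP
  obtain ⟨m, -, hm⟩ := Nat.exists_mul_mod_eq_one_of_coprime hk hp
  have hd := Nat.div_add_mod (k * m) p
  rw [hm] at hd
  have := hkP.nsmul h m
  rw [← mul_nsmul, ← hd, add_nsmul, mul_nsmul, hpP, nsmul_zero, zero_add, one_nsmul] at this
  exact hP this

/-- The reduction of `P` has exact order `p`, so for `1 < k < p - 1` the points `kP` and `±P` have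
distinct reductions and the chord through `kP` and `P` has a unit denominator. The doubling step
uses that `y` is a unit. -/
lemma exists_nsmul_congruent (hε0 : 0 ≤ ε) (hε : ε < 1) (h : GoodCoeffs a b)
    (h' : GoodCoeffs a' b') (ha : IntegralCong ε a a') (hp : p.Prime) {x y x' y' : K}
    (h₁ : (shortCurve a b).toAffine.Nonsingular x y)
    (h₁' : (shortCurve a' b').toAffine.Nonsingular x' y') (hx : IntegralCong ε x x')
    (hy : IntegralCong ε y y') (hyn : ‖y‖ = 1) (hpP : p • some x y h₁ = 0) {k : ℕ} (hk0 : 0 < k)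
    (hkp : k < p) :
    ∃ u v huv u' v' huv', k • some x y h₁ = some u v huv ∧ k • some x' y' h₁' = some u' v' huv' ∧
      IntegralCong ε u u' ∧ IntegralCong ε v v' := by
  have hker : ∀ j, 0 < j → j < p → ¬(j • some x y h₁).InKernel := fun j hj0 hjp =>
    not_inKernel_nsmul_of_coprime h (P := some x y h₁) (not_lt.mpr hx.left) hpP hp.one_lt
      (Nat.coprime_of_lt_prime hj0.ne' hjp hp).symm
  have hunit : ∀ {s t : K}, IntegralCong ε s t → ‖s‖ = 1 → ‖t‖ = 1 := fun hst hs => by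
    rw [← hs]
    exact norm_eq_of_norm_sub_lt (by rw [norm_sub_rev, hs]; exact hst.sub.trans_lt hε)
  induction k, hk0 using Nat.le_induction with
  | base => exact ⟨x, y, h₁, x', y', h₁', one_nsmul _, one_nsmul _, hx, hy⟩
  | succ k hk ih =>
    obtain ⟨u, v, huv, u', v', huv', e, e', hu, hv⟩ := ih (by lia)
    rw [succ_nsmul, succ_nsmul, e, e']
    refine integralCong_add hε0 h h' ha huv h₁ huv' h₁' hu hv hx hy ?_
    rcases hk.eq_or_lt with rfl | hk1
    · right
      rw [one_nsmul, some.injEq] at e e'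
      exact ⟨⟨e.1.symm, e.2.symm, e.2 ▸ hyn⟩, ⟨e'.1.symm, e'.2.symm, e'.2 ▸ hunit hy hyn⟩⟩
    · left
      -- If `u` and `x` had the same reduction, then `kP` would reduce to `-P` or to `P`, putting
      -- `(k + 1)P` or `(k - 1)P` in the kernel.
      have hux : ‖u - x‖ = 1 := by
        by_contra hne
        have hlt := lt_of_le_of_ne (norm_sub_le_of_le_ultra hu.left hx.left) hne
        by_cases hvy : ‖v - y‖ = 1
        · refine hker (k + 1) (by lia) hkp ?_
          rw [succ_nsmul, e]
          exact (add_inKernel_of_congruent_neg h hlt huv h₁ hu.left hx.left le_rfl hvy).1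
        · have hvy' := lt_of_le_of_ne (norm_sub_le_of_le_ultra hv.left hy.left) hvy
          have h2y : ‖2 * y‖ = 1 := by rw [norm_mul, h.two, hyn, mul_one]
          have hadd : ‖v - -y‖ = 1 := by
            rw [show v - -y = 2 * y + (v - y) by ring, norm_add_eq_left_of_lt (by rwa [h2y]), h2y]
          have hn : (shortCurve a b).toAffine.Nonsingular x (-y) := by
            rw [← shortCurve_negY a b x y]
            exact (Affine.nonsingular_neg ..).mpr h₁
          have hneg : -some x y h₁ = some x (-y) hn := by
            rw [neg_some]
            simp only [shortCurve_negY]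
          refine hker (k - 1) (by lia) (by lia) ?_
          have hk' : (k - 1) • some x y h₁ = k • some x y h₁ + -some x y h₁ := by
            rw [eq_add_neg_iff_add_eq, ← succ_nsmul, Nat.sub_add_cancel hk]
          rw [hk', e, hneg]
          exact (add_inKernel_of_congruent_neg h hlt huv hn hu.left hx.left le_rfl hadd).1
      exact ⟨hux, hunit (hu.diff hx) hux⟩

/-- Given curves congruent modulo `p²`, a nonzero point of order `p` on the first deforms to a
point of the second whose multiple by `p` is trivial modulo `p²`. -/
lemma exists_nsmul_inKernel_of_congruent [CompleteSpace K] (hp : p.Prime) (hp0 : (p : K) ≠ 0)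
    (hp1 : ‖(p : K)‖ < 1) (h : GoodCoeffs a b) (h' : GoodCoeffs a' b')
    (ha : IntegralCong (‖(p : K)‖ ^ 2) a a') (hb : IntegralCong (‖(p : K)‖ ^ 2) b b')
    {P : (shortCurve a b).toAffine.Point} (hP : p • P = 0) (hP0 : P ≠ 0) :
    ∃ P' : (shortCurve a' b').toAffine.Point, (p • P').InKernel ∧
      ‖(p • P').zCoord‖ ≤ ‖(p : K)‖ ^ 2 ∧ (P'.InKernel → ‖(p : K)‖ < ‖P'.zCoord‖) := by
  have hε0 : 0 ≤ ‖(p : K)‖ ^ 2 := by positivity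
  have hε : ‖(p : K)‖ ^ 2 < 1 := pow_lt_one₀ (norm_nonneg _) hp1 (by simp)
  by_cases hk : P.InKernel
  · obtain ⟨P', hk', hz, hw⟩ := exists_congruent_point_of_inKernel h h' ha hb hk
    refine ⟨P', hk'.nsmul h' p, ?_, fun _ => ?_⟩
    · have := (integralCong_nsmul_of_inKernel hε0 h h' ha hb hk hk'
        (hz.symm ▸ .refl hε0 (hk.norm_zCoord_lt h).le) hw p).1.sub
      rwa [hP, show (0 : (shortCurve a b).toAffine.Point).zCoord = 0 from rfl, zero_sub,
        norm_neg] at this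
    · rw [hz]
      exact hk.norm_lt_of_nsmul_eq_zero h hp0 hp1 hP0 hP
  · rcases P with _ | ⟨x, y, h₁⟩
    · exact absurd rfl hP0
    have hx : ‖x‖ ≤ 1 := not_lt.mp hk
    have e := shortCurve_equation_iff.mp h₁.1
    have hy := h.norm_y_le e hx
    have hp2 : 2 < p := by
      refine lt_of_le_of_ne hp.two_le ?_
      rintro rfl
      exact hp1.ne (by exact_mod_cast h.two)
    -- Otherwise `2P` would be in the kernel, although 2 is prime to `p`.
    have hyn : ‖y‖ = 1 := by
      by_contra hne
      refine not_inKernel_nsmul_of_coprime h hk hP hp.one_lt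
        (Nat.coprime_of_lt_prime two_ne_zero hp2 hp).symm ?_
      rw [two_nsmul]
      exact add_self_inKernel h h₁ hx (lt_of_le_of_ne hy hne)
    have hxx : IntegralCong (‖(p : K)‖ ^ 2) x x := .refl hε0 hx
    have hc : IntegralCong (‖(p : K)‖ ^ 2) (x ^ 3 + a * x + b) (x ^ 3 + a' * x + b') :=
      ((hxx.pow hε0 3).add (ha.mul hxx)).add hb
    obtain ⟨y', e', hyy⟩ := exists_sq_of_congruent h.two hyn hε
      (c := x ^ 3 + a' * x + b') (by rw [e, norm_sub_rev]; exact hc.sub)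
    have hyc : IntegralCong (‖(p : K)‖ ^ 2) y y' := ⟨hy, h'.norm_y_le e' hx, hyy⟩
    have h₁' := h'.nonsingular e'
    -- Affine congruences stop at `p - 1`, since `pP` is the point at infinity. As `(p - 1)P = -P`,
    -- the point `(p - 1)P'` is congruent to `-P'`, and the last addition is of nearly opposite
    -- points.
    obtain ⟨u, v, huv, u', v', huv', ek, ek', hu, hv⟩ := exists_nsmul_congruent hε0 hε h h' ha hp
      h₁ h₁' hxx hyc hyn hP (k := p - 1) (by lia) (by lia)
    have hpred : ∀ {a b : K} (R : (shortCurve a b).toAffine.Point), p • R = (p - 1) • R + R :=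
      fun R => by rw [← succ_nsmul, Nat.sub_add_cancel hp.one_lt.le]
    have hneg := hpred (some x y h₁)
    rw [hP, eq_comm, add_eq_zero_iff_eq_neg, ek, neg_some, some.injEq, shortCurve_negY] at hneg
    rw [hneg.1] at hu
    rw [hneg.2] at hv
    have h2y : ‖-(2 * y)‖ = 1 := by rw [norm_neg, norm_mul, h.two, hyn, mul_one]
    have hvy : ‖v' - y'‖ = 1 := by
      have := (hv.diff hyc).sub
      rw [← h2y]
      refine norm_eq_of_norm_sub_lt ?_
      rw [h2y, norm_sub_rev, show -(2 * y) = -y - y by ring]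
      exact this.trans_lt hε
    have hkey := add_inKernel_of_congruent_neg h' hε huv' h₁' hu.right hx
      (by rw [norm_sub_rev]; exact hu.sub) hvy
    rw [← ek', ← hpred] at hkey
    exact ⟨_, hkey.1, hkey.2, fun hk' => absurd hk' hk⟩

omit [DecidableEq K] in
/-- Curves with good reduction that are congruent modulo `p²` have points of order `p` over the
same complete fields. -/
theorem hasTorsion_of_congruent [CompleteSpace K] (hp : p.Prime) (hp0 : (p : K) ≠ 0)
    (hp1 : ‖(p : K)‖ < 1) (h : GoodCoeffs a b) (h' : GoodCoeffs a' b')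
    (ha : IntegralCong (‖(p : K)‖ ^ 2) a a') (hb : IntegralCong (‖(p : K)‖ ^ 2) b b')
    (ht : (shortCurve a b).HasTorsion p) : (shortCurve a' b').HasTorsion p := by
  classical
  obtain ⟨P, hP, hP0⟩ := ht
  obtain ⟨P', hk, hz, hP'⟩ := exists_nsmul_inKernel_of_congruent hp hp0 hp1 h h' ha hb hP hP0
  obtain ⟨Q, hQ, hQz, hpQ⟩ := exists_nsmul_eq_of_inKernel h' hp0 hp1 hk hz
  refine ⟨P' - Q, ?_, ?_⟩
  · rw [nsmul_sub, hpQ, sub_self]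
  · rw [sub_ne_zero]
    rintro rfl
    -- If `P' = Q`, then `P'` is in the kernel and `|z|` is both greater than `|p|` and at most
    -- `|p|`.
    exact absurd hQz (not_le.mpr (hP' hQ))

end Torsion

/-! ### Short forms, integral models over `ℤ_p`, and finite extensions of `ℚ_p`. -/

lemma exists_variableChange_eq_shortCurve {F : Type*} [Field F] (h2 : (2 : F) ≠ 0)
    (h3 : (3 : F) ≠ 0) (W : WeierstrassCurve F) :
    ∃ C : VariableChange F, C • W = shortCurve (-W.c₄ / 48) (-W.c₆ / 864) := by
  have h48 : (48 : F) ≠ 0 := by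
    rw [show (48 : F) = 2 ^ 4 * 3 by norm_num]
    positivity
  have h864 : (864 : F) ≠ 0 := by
    rw [show (864 : F) = 2 ^ 5 * 3 ^ 3 by norm_num]
    positivity
  have h12 : (12 : F) ≠ 0 := by
    rw [show (12 : F) = 2 ^ 2 * 3 by norm_num]
    positivity
  -- Completing the square and the cube, without rescaling.
  refine ⟨⟨1, -W.b₂ / 12, -W.a₁ / 2, -(W.a₃ - W.b₂ / 12 * W.a₁) / 2⟩, ?_⟩
  ext <;> simp only [variableChange_def, shortCurve, c₄, c₆, b₂, b₄, b₆, inv_one, Units.val_one] <;>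
  · field_simp
    ring

section Padic

variable {p : ℕ} [Fact p.Prime]

lemma norm_sub_le_of_toZModPow_eq {n : ℕ} {x y : ℤ_[p]}
    (h : PadicInt.toZModPow n x = PadicInt.toZModPow n y) : ‖x - y‖ ≤ ‖(p : ℤ_[p])‖ ^ n := by
  rw [← sub_eq_zero, ← map_sub, ← RingHom.mem_ker, PadicInt.ker_toZModPow,
    Ideal.mem_span_singleton] at h
  obtain ⟨c, hc⟩ := h
  rw [hc, norm_mul, norm_pow]
  exact mul_le_of_le_one_right (by positivity) (PadicInt.norm_le_one c)

variable {K : Type*} [NormedField K] [IsUltrametricDist K] [CompleteSpace K]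

/-- Since 48 and 864 are units, the congruence of the models passes through `c₄` and `c₆` to their
short forms. -/
lemma hasTorsion_map_of_map_toZModPow_eq (hp2 : p ≠ 2) (hp3 : p ≠ 3) (φ : ℤ_[p] →+* K)
    (hφ : ∀ x, ‖φ x‖ = ‖x‖) {M₁ M₂ : WeierstrassCurve ℤ_[p]} (hM₁ : ‖M₁.Δ‖ = 1)
    (hM₂ : ‖M₂.Δ‖ = 1) (h : M₁.map (PadicInt.toZModPow 2) = M₂.map (PadicInt.toZModPow 2))
    (ht : (M₁.map φ).HasTorsion p) : (M₂.map φ).HasTorsion p := by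
  have hp := Fact.out (p := p.Prime)
  have hprime : ∀ q : ℕ, q.Prime → p ≠ q → ‖(q : K)‖ = 1 := fun q hq hne => by
    rw [← map_natCast φ, hφ]
    exact PadicInt.norm_natCast_eq_one_iff.mpr ((Nat.coprime_primes hp hq).mpr hne)
  have n2 : ‖(2 : K)‖ = 1 := by exact_mod_cast hprime 2 Nat.prime_two hp2
  have n3 : ‖(3 : K)‖ = 1 := by exact_mod_cast hprime 3 Nat.prime_three hp3
  have h2 : (2 : K) ≠ 0 := norm_ne_zero_iff.mp (by simp [n2])
  have h3 : (3 : K) ≠ 0 := norm_ne_zero_iff.mp (by simp [n3])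
  have n48 : ‖(48 : K)‖ = 1 := by
    rw [show (48 : K) = 2 ^ 4 * 3 by norm_num]
    simp [n2, n3]
  have n864 : ‖(864 : K)‖ = 1 := by
    rw [show (864 : K) = 2 ^ 5 * 3 ^ 3 by norm_num]
    simp [n2, n3]
  have hle : ∀ x, ‖φ x‖ ≤ 1 := fun x => (hφ x).trans_le (PadicInt.norm_le_one x)
  have hpφ : ‖(p : K)‖ = ‖(p : ℤ_[p])‖ := by rw [← hφ, map_natCast]
  have hp1 : ‖(p : K)‖ < 1 := by
    rw [hpφ]
    rw [PadicInt.norm_p]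
    exact inv_lt_one_of_one_lt₀ (by exact_mod_cast hp.one_lt)
  have hp0 : (p : K) ≠ 0 := by
    rw [← norm_ne_zero_iff, hpφ, norm_ne_zero_iff]
    exact_mod_cast hp.ne_zero
  have hgood : ∀ M : WeierstrassCurve ℤ_[p], ‖M.Δ‖ = 1 →
      GoodCoeffs (-(M.map φ).c₄ / 48) (-(M.map φ).c₆ / 864) := fun M hM => by
    refine ⟨?_, ?_, n2, ?_⟩
    · rw [norm_div, norm_neg, n48, div_one, map_c₄]
      exact hle _
    · rw [norm_div, norm_neg, n864, div_one, map_c₆]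
      exact hle _
    -- This is `c₄³ - c₆² = 1728Δ`, rescaled.
    · have hd : 4 * (-(M.map φ).c₄ / 48) ^ 3 + 27 * (-(M.map φ).c₆ / 864) ^ 2 =
          -(M.map φ).Δ / 2 ^ 4 := by
        have h48 : (48 : K) ≠ 0 := norm_ne_zero_iff.mp (by simp [n48])
        have h864 : (864 : K) ≠ 0 := norm_ne_zero_iff.mp (by simp [n864])
        field_simp
        linear_combination 47775744 * (M.map φ).c_relation
      rw [hd, norm_div, norm_neg, norm_pow, n2, map_Δ, hφ, hM]
      simp
  have hell : ∀ M : WeierstrassCurve ℤ_[p], ‖M.Δ‖ = 1 → (M.map φ).IsElliptic := fun M hM => by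
    rw [isElliptic_iff, isUnit_iff_ne_zero, map_Δ, ← norm_ne_zero_iff, hφ, hM]
    exact one_ne_zero
  have hcong : ∀ {x y : ℤ_[p]}, PadicInt.toZModPow 2 x = PadicInt.toZModPow 2 y →
      IntegralCong (‖(p : K)‖ ^ 2) (φ x) (φ y) := fun {x y} hxy => by
    refine ⟨hle x, hle y, ?_⟩
    rw [← map_sub, hφ, hpφ]
    exact norm_sub_le_of_toZModPow_eq hxy
  have hε0 : 0 ≤ ‖(p : K)‖ ^ 2 := by positivity
  have hc₄ : PadicInt.toZModPow 2 M₁.c₄ = PadicInt.toZModPow 2 M₂.c₄ := by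
    rw [← map_c₄, h, map_c₄]
  have hc₆ : PadicInt.toZModPow 2 M₁.c₆ = PadicInt.toZModPow 2 M₂.c₆ := by
    rw [← map_c₆, h, map_c₆]
  have ell₁ := hell M₁ hM₁
  have ell₂ := hell M₂ hM₂
  obtain ⟨C₁, hC₁⟩ := exists_variableChange_eq_shortCurve h2 h3 (M₁.map φ)
  obtain ⟨C₂, hC₂⟩ := exists_variableChange_eq_shortCurve h2 h3 (M₂.map φ)
  rw [← hasTorsion_variableChange_iff C₁, hC₁] at ht
  rw [← hasTorsion_variableChange_iff C₂, hC₂]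
  refine hasTorsion_of_congruent hp hp0 hp1 (hgood M₁ hM₁) (hgood M₂ hM₂) ?_ ?_ ht
  · rw [map_c₄, map_c₄]
    exact (hcong hc₄).neg.div (.refl hε0 n48.le) n48 n48
  · rw [map_c₆, map_c₆]
    exact (hcong hc₆).neg.div (.refl hε0 n864.le) n864 n864

/-- The spectral norm makes a finite extension of `ℚ_p` a complete ultrametric field whose norm
extends that of `ℚ_p`; ramification plays no role. -/
lemma hasTorsion_map_algebraMap_of_map_toZModPow_eq (hp2 : p ≠ 2) (hp3 : p ≠ 3) (K : Type*)
    [Field K] [Algebra ℚ_[p] K] [FiniteDimensional ℚ_[p] K] {M₁ M₂ : WeierstrassCurve ℤ_[p]}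
    (hM₁ : ‖M₁.Δ‖ = 1) (hM₂ : ‖M₂.Δ‖ = 1)
    (h : M₁.map (PadicInt.toZModPow 2) = M₂.map (PadicInt.toZModPow 2))
    (ht : (M₁.map ((algebraMap ℚ_[p] K).comp (algebraMap ℤ_[p] ℚ_[p]))).HasTorsion p) :
    (M₂.map ((algebraMap ℚ_[p] K).comp (algebraMap ℤ_[p] ℚ_[p]))).HasTorsion p := by
  let _ : NormedField K := spectralNorm.normedField ℚ_[p] K
  have hu : IsUltrametricDist K :=
    IsUltrametricDist.isUltrametricDist_of_isNonarchimedean_norm isNonarchimedean_spectralNorm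
  have hc : CompleteSpace K := spectralNorm.completeSpace ℚ_[p] K
  have hφ : ∀ x, ‖(algebraMap ℚ_[p] K).comp (algebraMap ℤ_[p] ℚ_[p]) x‖ = ‖x‖ :=
    fun x => spectralNorm_extends _
  exact hasTorsion_map_of_map_toZModPow_eq hp2 hp3 _ hφ hM₁ hM₂ h ht

lemma exists_integral_model_of_isGoodReductionMod {E : WeierstrassCurve ℚ_[p]} {n : ℕ}
    {W : WeierstrassCurve (ZMod (p ^ n))} (h : E.IsGoodReductionMod n W) :
    ∃ (M : WeierstrassCurve ℤ_[p]) (C : VariableChange ℚ_[p]), M.baseChange ℚ_[p] = C • E ∧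
      ‖M.Δ‖ = 1 ∧ M.map (PadicInt.toZModPow n) = W := by
  obtain ⟨C, hC, rfl⟩ := h
  refine ⟨_, C, baseChange_integralModel_eq ℤ_[p] (C • E), ?_, rfl⟩
  have hΔ := hC.goodReduction
  rw [← integralModel_Δ_eq ℤ_[p]] at hΔ
  rw [← PadicInt.isUnit_iff]
  by_contra hu
  refine hΔ.not_lt ?_
  exact (IsDedekindDomain.HeightOneSpectrum.valuation_lt_one_iff_mem _ _).mpr
    ((IsLocalRing.mem_maximalIdeal _).mpr hu)

/-- The surjection from `ℤ_p` to the nontrivial ring `ℤ/pⁿ` is a local homomorphism, so the unit `u`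
lifts to a unit. -/
lemma exists_variableChange_map_toZModPow {n : ℕ} (hn : n ≠ 0)
    (C : VariableChange (ZMod (p ^ n))) :
    ∃ C' : VariableChange ℤ_[p], C'.map (PadicInt.toZModPow n) = C := by
  have : Fact (1 < p ^ n) := ⟨Nat.one_lt_pow hn (Fact.out (p := p.Prime)).one_lt⟩
  have hs : Function.Surjective (PadicInt.toZModPow n : ℤ_[p] →+* ZMod (p ^ n)) :=
    ZMod.ringHom_surjective _
  have hloc := hs.isLocalHom
  obtain ⟨u, hu⟩ := IsLocalRing.surjective_units_map_of_local_ringHom _ hs hloc C.u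
  obtain ⟨r, hr⟩ := hs C.r
  obtain ⟨s, hs'⟩ := hs C.s
  obtain ⟨t, ht⟩ := hs C.t
  exact ⟨⟨u, r, s, t⟩, VariableChange.ext hu hr hs' ht⟩

end Padic

end WeierstrassCurve

/-! ### The theorem. -/

open WeierstrassCurve in
theorem theorem1 (p : ℕ) [Fact p.Prime] (hp2 : p ≠ 2) (hp3 : p ≠ 3)
    (E₁ E₂ : WeierstrassCurve ℚ_[p]) [E₁.IsElliptic] [E₂.IsElliptic]
    (W₁ W₂ : WeierstrassCurve (ZMod (p ^ 2)))
    (h₁ : E₁.IsGoodReductionMod 2 W₁) (h₂ : E₂.IsGoodReductionMod 2 W₂)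
    (hiso : W₁.Isomorphic W₂) :
    E₁.pDegree = E₂.pDegree := by
  obtain ⟨M₁, C₁, e₁, hM₁, m₁⟩ := exists_integral_model_of_isGoodReductionMod h₁
  obtain ⟨M₂, C₂, e₂, hM₂, m₂⟩ := exists_integral_model_of_isGoodReductionMod h₂
  obtain ⟨D, hD⟩ := hiso
  obtain ⟨D', rfl⟩ := exists_variableChange_map_toZModPow two_ne_zero D
  refine pDegree_eq_of_hasTorsion_iff fun K hK => ?_
  let φ : ℤ_[p] →+* K := (algebraMap ℚ_[p] K).comp (algebraMap ℤ_[p] ℚ_[p])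
  have hE : ∀ (E : WeierstrassCurve ℚ_[p]) [E.IsElliptic] (M : WeierstrassCurve ℤ_[p])
      (C : VariableChange ℚ_[p]), M.baseChange ℚ_[p] = C • E →
      ((E.baseChange K).HasTorsion p ↔ (M.map φ).HasTorsion p) := by
    intro E _ M C e
    have : (E.baseChange K).IsElliptic :=
      inferInstanceAs (E.map (algebraMap ℚ_[p] K)).IsElliptic
    have : M.map φ = (C.map (algebraMap ℚ_[p] K)) • E.baseChange K := by
      rw [baseChange, map_variableChange, ← e, baseChange, map_map]
    rw [this]
    exact (hasTorsion_variableChange_iff _).symm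
  rw [hE E₁ M₁ C₁ e₁, hE E₂ M₂ C₂ e₂]
  -- Replacing `M₁` by `D' • M₁` turns the isomorphism modulo `p²` into equality of coefficients
  -- modulo `p²`, and the discriminant only changes by a unit.
  have hM₁' : ‖(D' • M₁).Δ‖ = 1 := by
    rw [variableChange_Δ, norm_mul, norm_pow, hM₁, mul_one]
    rw [PadicInt.isUnit_iff.mp (Units.isUnit _), one_pow]
  have hmod : (D' • M₁).map (PadicInt.toZModPow 2) = M₂.map (PadicInt.toZModPow 2) := by
    rw [← map_variableChange, m₁, m₂, hD]
  have ell : (M₁.map φ).IsElliptic := by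
    rw [isElliptic_iff, map_Δ]
    exact (PadicInt.isUnit_iff.mpr hM₁).map φ
  rw [← hasTorsion_variableChange_iff (W := M₁.map φ) (D'.map φ), map_variableChange]
  exact ⟨hasTorsion_map_algebraMap_of_map_toZModPow_eq hp2 hp3 K hM₁' hM₂ hmod,
    hasTorsion_map_algebraMap_of_map_toZModPow_eq hp2 hp3 K hM₂ hM₁' hmod.symm⟩
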